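/- Fix real numbers $\varepsilon_1\ge\varepsilon_2\ge 0$ and $\delta_1,\delta_2\in[0,1]$, and an integer $k\ge 0$. A mechanism $M$ assigns to each database $d$ a probability measure $M(d)$ on a measurable space; for a symmetric neighbouring relation on databases it is $(\varepsilon,\delta)$-DP if $M(d)(S)\le e^{\varepsilon}M(d')(S)+\delta$ for all neighbours $d,d'$ and all measurable $S$. For probability measures $P_0,P_1$ on the same space, let $f(t)$ be the infimum of the type-II error over all randomized tests of $P_0$ against $P_1$ with type-I error at most $t$, and let the privacy region be $$\mathcal R(P_0,P_1)=\{(\beta_{\mathrm I},\beta_{\mathrm{II}}): 0\le\beta_{\mathrm I}\le 1,\ f(\beta_{\mathrm I})\le\beta_{\mathrm{II}}\le 1-\beta_{\mathrm I}\}.$$ Let $\mathcal T=\{(\beta_{\mathrm I},\beta_{\mathrm{II}}):\beta_{\mathrm I},\beta_{\mathrm{II}}\ge0,\ \beta_{\mathrm I}+\beta_{\mathrm{II}}\le1\}$ and $$\mathcal R(\varepsilon,\delta)=\{\beta\in\mathcal T:\ \beta_{\mathrm I}+e^{\varepsilon}\beta_{\mathrm{II}}\ge 1-\delta,\ e^{\varepsilon}\beta_{\mathrm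 I}+\beta_{\mathrm{II}}\ge1-\delta\}.$$ Binary $\varepsilon$-randomized response has masses $\left(\frac{e^{\varepsilon}}{e^{\varepsilon}+1},\frac1{e^{\varepsilon}+1}\right)$ under $H_0$ and $\left(\frac1{e^{\varepsilon}+1},\frac{e^{\varepsilon}}{e^{\varepsilon}+1}\right)$ under $H_1$. Let $\mathcal R^{x,y}$ be the privacy region of $x$ independent copies of $\varepsilon_1$-randomized response together with $y$ independent copies of $\varepsilon_2$-randomized response. Put $$\delta=\min(\delta_1,\delta_2),\qquad \alpha=1-\min\left(1,\frac{(\delta_2-\delta)(e^{\varepsilon_1}+1)}{(1-\delta)(e^{\varepsilon_1}-e^{\varepsilon_2})}\right),$$ where the quotient is read as $0$ if $\varepsilon_1=\varepsilon_2$ or $\delta=1$. (Thus $\delta=\delta_1$ unless $\delta_2<\delta_1$, in which case the first constraint is implied by the second.) Let $M^*_{\delta,\alpha}$ be the mechanism on the two neighbouring databases $H_0,H_1$ that with probability $(1-\delta)(1-\alpha)$ runs $\varepsilon_1$-randomized response, with probability $(1-\delta)\alpha$ runs $\varepsilon_2$-randomized response, and with probability $\delta$ reveals the hypothesis, the chosen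 component being visible in the output. Explicitly, on the output set $\{-1,0,1,2,3,4\}$ its masses under $H_0$ are $$\delta,\ \ (1-\delta)(1-\alpha)\tfrac{e^{\varepsilon_1}}{e^{\varepsilon_1}+1},\ \ (1-\delta)\alpha\tfrac{e^{\varepsilon_2}}{e^{\varepsilon_2}+1},\ \ (1-\delta)\alpha\tfrac{1}{e^{\varepsilon_2}+1},\ \ (1-\delta)(1-\alpha)\tfrac{1}{e^{\varepsilon_1}+1},\ \ 0,$$ and under $H_1$ the same list in reverse order. With Minkowski sums and dilations, put $$\mathcal R_k^0=\sum_{j=0}^k\binom kj(1-\alpha)^{k-j}\alpha^{j}\,\mathcal R^{k-j,j},\qquad \mathcal R_k=\bigl(1-(1-\delta)^k\bigr)\mathcal T+(1-\delta)^k\,\mathcal R_k^0 .$$ Then: 1. $\delta,\alpha\in[0,1]$, and $M^*_{\delta,\alpha}$ is a mechanism that is both $(\varepsilon_1,\delta_1)$-DP and $(\varepsilon_2,\delta_2)$-DP. 2. The privacy region of the $k$-fold composition of $M^*_{\delta,\alpha}$ with itself is exactly $\mathcal R_k$, and that of the mixture $M^*_{0,\alpha}$ without the revealing component is exactly $\mathcal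 R_k^0$. 3. For all $x,y\ge0$, $\mathcal R^{x,y}=\bigcap\mathcal R(\varepsilon_{a,b},\delta_{a,b})$, the intersection being over all integers $0\le a\le x$, $0\le b\le y$ with $\varepsilon_{a,b}:=\varepsilon_1(x-2a)+\varepsilon_2(y-2b)\ge0$, where $$\delta_{a,b}=\frac{1}{(e^{\varepsilon_1}+1)^x(e^{\varepsilon_2}+1)^y}\sum_{j=0}^y\sum_{i=0}^x\binom xi\binom yj\max\left(0,\ e^{i\varepsilon_1+j\varepsilon_2}-e^{\varepsilon_{a,b}}e^{(x-i)\varepsilon_1+(y-j)\varepsilon_2}\right).$$ 4. $\mathcal R_k$ is the largest possible region: if $M$ is any mechanism that is both $(\varepsilon_1,\delta_1)$-DP and $(\varepsilon_2,\delta_2)$-DP and $d_0,d_1$ are neighbours, then $\mathcal R(M(d_0)^{\otimes k},M(d_1)^{\otimes k})\subseteq\mathcal R_k$. The same inclusion holds for the adaptive composition of $k$ mechanisms, each satisfying both constraints, in which an adversary with private coins chooses each mechanism and each pair of neighbouring databases as a function of its coins and of the previous outputs (with measurable dependence of the output laws), and the two hypotheses are compared through the coins and the $k$ outputs. -/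

import Mathlib

open MeasureTheory ProbabilityTheory
open scoped Pointwise

universe u v

noncomputable section

namespace DoubleDP

/-! ### Hypothesis testing: trade-off function and privacy region -/

/-- The trade-off function of the test of `H₀ : P` against `H₁ : Q`: the least type-II error of a
(randomized) decision rule whose type-I error is at most `t`. Here `φ y` is the probability that the
rule decides for `H₁` on observing `y`. -/
def tradeoff {Y : Type u} [MeasurableSpace Y] (P Q : Measure Y) (t : ℝ) : ℝ :=
  sInf ((fun φ : Y → ℝ => ∫ y, (1 - φ y) ∂Q) ''
    {φ : Y → ℝ | Measurable φ ∧ (∀ y, 0 ≤ φ y ∧ φ y ≤ 1) ∧ ∫ y, φ y ∂P ≤ t})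

/-- The privacy region: all pairs `(β_I, β_II)` with `f (β_I) ≤ β_II ≤ 1 - β_I`, where `f` is the
trade-off function. -/
def privacyRegion {Y : Type u} [MeasurableSpace Y] (P Q : Measure Y) : Set (ℝ × ℝ) :=
  {β | 0 ≤ β.1 ∧ β.1 ≤ 1 ∧ tradeoff P Q β.1 ≤ β.2 ∧ β.2 ≤ 1 - β.1}

/-- The region of the constraint `(ε, δ)`. -/
def dpRegion (ε δ : ℝ) : Set (ℝ × ℝ) :=
  {β | 0 ≤ β.1 ∧ 0 ≤ β.2 ∧ β.1 + β.2 ≤ 1 ∧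
    1 - δ ≤ β.1 + Real.exp ε * β.2 ∧ 1 - δ ≤ Real.exp ε * β.1 + β.2}

/-- The full triangle `β_I, β_II ≥ 0`, `β_I + β_II ≤ 1`: the region of a mechanism that reveals the
hypothesis. -/
def fullRegion : Set (ℝ × ℝ) :=
  {β | 0 ≤ β.1 ∧ 0 ≤ β.2 ∧ β.1 + β.2 ≤ 1}

/-! ### Mechanisms and their composition -/

/-- `M` is `(ε, δ)`-differentially private for the neighbouring relation `adj`. -/
def IsDP {𝒟 : Type v} {Y : Type u} [MeasurableSpace Y] (adj : 𝒟 → 𝒟 → Prop)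
    (M : 𝒟 → Measure Y) (ε δ : ℝ) : Prop :=
  ∀ d d', adj d d' → ∀ S : Set Y, MeasurableSet S →
    (M d).real S ≤ Real.exp ε * (M d').real S + δ

/-- The `k`-fold composition of `M` with itself: `k` independent runs on the same database. -/
def kFold {𝒟 : Type v} {Y : Type u} [MeasurableSpace Y] (M : 𝒟 → Measure Y) (k : ℕ) (d : 𝒟) :
    Measure (Fin k → Y) :=
  Measure.pi fun _ => M d

/-- What an adversary has seen after `n` rounds: its own coins, of type `R`, and the `n` outputs. -/
def Transcript (R : Type u) (Y : ℕ → Type u) : ℕ → Type u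
  | 0 => R
  | n + 1 => Transcript R Y n × Y n

instance Transcript.instMeasurableSpace (R : Type u) (Y : ℕ → Type u) [MeasurableSpace R]
    [∀ n, MeasurableSpace (Y n)] : ∀ n, MeasurableSpace (Transcript R Y n)
  | 0 => inferInstanceAs (MeasurableSpace R)
  | n + 1 =>
    letI := Transcript.instMeasurableSpace R Y n
    inferInstanceAs (MeasurableSpace (Transcript R Y n × Y n))

/-- An adaptive composition experiment. In round `n` the adversary, knowing the transcript `h`,
chooses a mechanism `mech n h` and a pair of databases `db false n h`, `db true n h`; it is then
shown the output of this mechanism on the database of the true hypothesis. -/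
structure AdaptiveComposition (𝒟 : Type v) (R : Type u) (Y : ℕ → Type u) [MeasurableSpace R]
    [∀ n, MeasurableSpace (Y n)] where
  coins : Measure R
  isProbabilityMeasure_coins : IsProbabilityMeasure coins
  mech : ∀ n, Transcript R Y n → 𝒟 → Measure (Y n)
  isProbabilityMeasure_mech : ∀ n h d, IsProbabilityMeasure (mech n h d)
  db : Bool → ∀ n, Transcript R Y n → 𝒟
  measurable_step : ∀ b n, Measurable fun h => mech n h (db b n h)

namespace AdaptiveComposition

variable {𝒟 : Type v} {R : Type u} {Y : ℕ → Type u} [MeasurableSpace R]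
  [∀ n, MeasurableSpace (Y n)]

/-- The law of the output of round `n` given the transcript, under hypothesis `b`. -/
def step (A : AdaptiveComposition 𝒟 R Y) (b : Bool) (n : ℕ) :
    Kernel (Transcript R Y n) (Y n) where
  toFun h := A.mech n h (A.db b n h)
  measurable' := A.measurable_step b n

/-- The law of the transcript after `n` rounds, under hypothesis `b`. -/
def law (A : AdaptiveComposition 𝒟 R Y) (b : Bool) : ∀ n, Measure (Transcript R Y n)
  | 0 => A.coins
  | n + 1 => A.law b n ⊗ₘ A.step b n

end AdaptiveComposition

/-! ### Randomized response, and the mixture with a revealing component -/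

/-- The measure on a finite set with point masses `p i`. -/
def ofMasses {n : ℕ} (p : Fin n → ℝ) : Measure (Fin n) :=
  ∑ i, ENNReal.ofReal (p i) • Measure.dirac i

/-- Binary randomized response with parameter `ε`; the databases are the two hypotheses. -/
def randomizedResponse (ε : ℝ) : Bool → Measure (Fin 2)
  | false => ofMasses ![Real.exp ε / (Real.exp ε + 1), 1 / (Real.exp ε + 1)]
  | true => ofMasses ![1 / (Real.exp ε + 1), Real.exp ε / (Real.exp ε + 1)]

/-- The mixture that runs randomized response with parameter `ε₁` (outputs `1`, `4`) with probability
`(1 - δ) (1 - α)`, randomized response with parameter `ε₂` (outputs `2`, `3`) with probability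
`(1 - δ) α`, and reveals the hypothesis (outputs `0`, `5`) with probability `δ`. -/
def mixture (ε₁ ε₂ δ α : ℝ) : Bool → Measure (Fin 6)
  | false => ofMasses ![
      δ,
      (1 - δ) * (1 - α) * (Real.exp ε₁ / (Real.exp ε₁ + 1)),
      (1 - δ) * α * (Real.exp ε₂ / (Real.exp ε₂ + 1)),
      (1 - δ) * α * (1 / (Real.exp ε₂ + 1)),
      (1 - δ) * (1 - α) * (1 / (Real.exp ε₁ + 1)),
      0]
  | true => ofMasses ![
      0,
      (1 - δ) * (1 - α) * (1 / (Real.exp ε₁ + 1)),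
      (1 - δ) * α * (1 / (Real.exp ε₂ + 1)),
      (1 - δ) * α * (Real.exp ε₂ / (Real.exp ε₂ + 1)),
      (1 - δ) * (1 - α) * (Real.exp ε₁ / (Real.exp ε₁ + 1)),
      δ]

/-- The probability of the revealing component. It is `δ₁` unless `δ₂ < δ₁`, in which case (for
`ε₂ ≤ ε₁`) the constraint `(ε₁, δ₁)` is implied by `(ε₂, δ₂)`. -/
def revealProb (δ₁ δ₂ : ℝ) : ℝ := min δ₁ δ₂

/-- The weight of the randomized response with parameter `ε₂`. The minimum with `1` only matters when
the constraint `(ε₂, δ₂)` is implied by `(ε₁, δ₁)`. The quotient is `0`, as it should be, when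
`ε₁ = ε₂` or when the probability of the revealing component is `1`. -/
def mixWeight (ε₁ δ₁ ε₂ δ₂ : ℝ) : ℝ :=
  1 - min 1 (((δ₂ - revealProb δ₁ δ₂) * (Real.exp ε₁ + 1)) /
    ((1 - revealProb δ₁ δ₂) * (Real.exp ε₁ - Real.exp ε₂)))

/-! ### The regions -/

/-- The privacy region of `x` randomized responses with parameter `ε₁` and `y` with parameter `ε₂`,
all independent. -/
def rrRegion (ε₁ ε₂ : ℝ) (x y : ℕ) : Set (ℝ × ℝ) :=
  privacyRegion
    ((kFold (randomizedResponse ε₁) x false).prod (kFold (randomizedResponse ε₂) y false))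
    ((kFold (randomizedResponse ε₁) x true).prod (kFold (randomizedResponse ε₂) y true))

/-- The logarithmic slopes of the boundary of `rrRegion ε₁ ε₂ x y`. -/
def rrEps (ε₁ ε₂ : ℝ) (x y a b : ℕ) : ℝ :=
  ε₁ * ((x : ℝ) - 2 * a) + ε₂ * ((y : ℝ) - 2 * b)

/-- The offset that belongs to the slope `rrEps ε₁ ε₂ x y a b`. -/
def rrDelta (ε₁ ε₂ : ℝ) (x y a b : ℕ) : ℝ :=
  (1 / (Real.exp ε₁ + 1)) ^ x * (1 / (Real.exp ε₂ + 1)) ^ y *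
    ∑ j ∈ Finset.range (y + 1), ∑ i ∈ Finset.range (x + 1),
      (x.choose i : ℝ) * (y.choose j : ℝ) *
        max 0 (Real.exp (i * ε₁ + j * ε₂) -
          Real.exp (rrEps ε₁ ε₂ x y a b) * Real.exp (((x : ℝ) - i) * ε₁ + ((y : ℝ) - j) * ε₂))

/-- The binomial mixture (a Minkowski combination) of the regions `rrRegion ε₁ ε₂ (k - j) j`. -/
def binomialRegion (ε₁ ε₂ α : ℝ) (k : ℕ) : Set (ℝ × ℝ) :=
  ∑ j ∈ Finset.range (k + 1),
    ((k.choose j : ℝ) * (1 - α) ^ (k - j) * α ^ j) • rrRegion ε₁ ε₂ (k - j) j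

/-- The mixture of the full triangle, with weight `1 - (1 - δ) ^ k`, and of `binomialRegion`. -/
def composedRegion (ε₁ ε₂ δ α : ℝ) (k : ℕ) : Set (ℝ × ℝ) :=
  (1 - (1 - δ) ^ k) • fullRegion + ((1 - δ) ^ k) • binomialRegion ε₁ ε₂ α k

end DoubleDP

end

/-! A pair of laws is encoded by its profile: for multipliers `s, t ≥ 0`, the largest value over all
tests of `s` times the power minus `t` times the type-I error. For finite laws with masses `p`, `q`
this is `∑ max 0 (s q - t p)`. By convex duality the profile determines the region
(`testRegion_eq_supportRegion`, `privacyRegion_eq_supportRegion`), and sums of profiles correspond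
to Minkowski sums of regions (`supportRegion_sum`).

Adding an independent observation acts on profiles by the linear operator `response p q`, and such
operators commute. On positively homogeneous functions the operator of the mixture is `δ • revealOp
+ (1 - δ) • mixOp`, where `mixOp` is the `α`-average of the two randomized-response operators.
Revealing is absorbing and the binomial theorem expands powers of `mixOp`. This gives the region of
the composed mixture (`observe_mixture_pow`, `mixOp_pow_eq_sum`).

For optimality, `gain_le_observe_mixture` shows that the two constraints bound the profile of a
single mechanism by that of the mixture. This is a planar linear program with five ranges of `s /
t`. `DominatedBy.compProd` carries the bound through one more round, conditionally on the past, so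
adaptivity gives nothing extra.

For the explicit intersection, the profile of randomized responses is piecewise linear in `t / s`,
with breakpoints at the likelihood ratios, and it is enough to impose the constraints there
(`rrRegion_eq_iInter`). -/

namespace DoubleDP

/-! ### Profiles: the hinge function and the operators that act on it -/

/-- The gain of the best test between two point masses with weights `t` under `H₀`, `s` under `H₁`. -/
def hinge : ℝ × ℝ → ℝ := fun x => max 0 (x.1 - x.2)

/-- Precomposition with the dilation `(s, t) ↦ (s a, t b)`. -/
def scale (a b : ℝ) : Module.End ℝ (ℝ × ℝ → ℝ) :=
  LinearMap.funLeft ℝ ℝ fun x => (x.1 * a, x.2 * b)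

/-- The operator that adds an independent observation with masses `p` under `H₀`, `q` under `H₁`. -/
def response {Z : Type*} [Fintype Z] (p q : Z → ℝ) : Module.End ℝ (ℝ × ℝ → ℝ) :=
  ∑ z, scale (q z) (p z)

@[simp] lemma scale_apply (a b : ℝ) (h : ℝ × ℝ → ℝ) (x : ℝ × ℝ) :
    scale a b h x = h (x.1 * a, x.2 * b) := rfl

lemma response_apply {Z : Type*} [Fintype Z] (p q : Z → ℝ) (h : ℝ × ℝ → ℝ) (x : ℝ × ℝ) :
    response p q h x = ∑ z, h (x.1 * q z, x.2 * p z) := by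
  simp [response, LinearMap.sum_apply, Finset.sum_apply]

lemma scale_mul_scale (a b c d : ℝ) : scale a b * scale c d = scale (a * c) (b * d) := by
  ext h x
  simp [Module.End.mul_apply, mul_assoc]

lemma scale_pow (a b : ℝ) (n : ℕ) : scale a b ^ n = scale (a ^ n) (b ^ n) := by
  induction n with
  | zero => ext h x; simp
  | succ n ih => rw [pow_succ, ih, scale_mul_scale, pow_succ, pow_succ]

lemma commute_scale (a b c d : ℝ) : Commute (scale a b) (scale c d) := by
  rw [Commute, SemiconjBy, scale_mul_scale, scale_mul_scale, mul_comm a, mul_comm b]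

lemma commute_response {Z W : Type*} [Fintype Z] [Fintype W] (p q : Z → ℝ) (p' q' : W → ℝ) :
    Commute (response p q) (response p' q') :=
  Commute.sum_left _ _ _ fun _ _ => Commute.sum_right _ _ _ fun _ _ => commute_scale _ _ _ _

lemma response_hinge_apply {Z : Type*} [Fintype Z] (p q : Z → ℝ) (s t : ℝ) :
    response p q hinge (s, t) = ∑ z, max 0 (s * q z - t * p z) := by
  rw [response_apply]; rfl

lemma response_hinge_one_zero {Z : Type*} [Fintype Z] (p : Z → ℝ) {q : Z → ℝ}
    (hq : ∀ z, 0 ≤ q z) : response p q hinge (1, 0) = ∑ z, q z := by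
  rw [response_hinge_apply]
  exact Finset.sum_congr rfl fun z _ => by simp [hq z]

/-! ### Regions of finite tests -/

/-- The pairs in the triangle of size `h (1, 0)` that satisfy all linear constraints given by `h`. -/
def supportRegion (h : ℝ × ℝ → ℝ) : Set (ℝ × ℝ) :=
  {β | 0 ≤ β.1 ∧ 0 ≤ β.2 ∧ β.1 + β.2 ≤ h (1, 0) ∧
    ∀ s t, 0 ≤ s → 0 ≤ t → s * h (1, 0) ≤ t * β.1 + s * β.2 + h (s, t)}

/-- The pairs in the triangle of size `∑ q` that dominate the pair of errors of a test. -/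
def testRegion {Z : Type*} [Fintype Z] (p q : Z → ℝ) : Set (ℝ × ℝ) :=
  {β | 0 ≤ β.1 ∧ 0 ≤ β.2 ∧ β.1 + β.2 ≤ ∑ z, q z ∧
    ∃ φ : Z → ℝ, (∀ z, 0 ≤ φ z ∧ φ z ≤ 1) ∧ ∑ z, φ z * p z ≤ β.1 ∧ ∑ z, (1 - φ z) * q z ≤ β.2}

section Finite

variable {Z W : Type*} [Fintype Z] [Fintype W] {p q : Z → ℝ} {p' q' : W → ℝ}

/-- The achievable error pairs form a compact convex set. If it missed the quadrant below `β`, a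
separating functional would give multipliers `s, t ≥ 0` whose Neyman–Pearson test contradicts `h`.
-/
lemma exists_test_of_forall_le (β : ℝ × ℝ)
    (h : ∀ s t, 0 ≤ s → 0 ≤ t →
      s * ∑ z, q z ≤ t * β.1 + s * β.2 + ∑ z, max 0 (s * q z - t * p z)) :
    ∃ φ : Z → ℝ, (∀ z, 0 ≤ φ z ∧ φ z ≤ 1) ∧ ∑ z, φ z * p z ≤ β.1 ∧
      ∑ z, (1 - φ z) * q z ≤ β.2 := by
  classical
  by_contra! hne
  let F : (Z → ℝ) → ℝ × ℝ := fun φ => (∑ z, φ z * p z, ∑ z, (1 - φ z) * q z)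
  let K : Set (Z → ℝ) := Set.Icc 0 1
  have hF : Continuous F := by fun_prop
  have hK : IsCompact (F '' K) := isCompact_Icc.image hF
  have hKc : Convex ℝ (F '' K) := by
    rintro _ ⟨φ, hφ, rfl⟩ _ ⟨ψ, hψ, rfl⟩ a b ha hb hab
    refine ⟨a • φ + b • ψ, convex_Icc (0 : Z → ℝ) 1 hφ hψ ha hb hab, ?_⟩
    have e1 : ∑ z, (a * φ z + b * ψ z) * p z = a * ∑ z, φ z * p z + b * ∑ z, ψ z * p z := by
      rw [Finset.mul_sum, Finset.mul_sum, ← Finset.sum_add_distrib]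
      exact Finset.sum_congr rfl fun z _ => by ring
    have e2 : ∑ z, (1 - (a * φ z + b * ψ z)) * q z =
        a * ∑ z, (1 - φ z) * q z + b * ∑ z, (1 - ψ z) * q z := by
      rw [Finset.mul_sum, Finset.mul_sum, ← Finset.sum_add_distrib]
      refine Finset.sum_congr rfl fun z _ => ?_
      rw [show 1 - (a * φ z + b * ψ z) = a * (1 - φ z) + b * (1 - ψ z) by linear_combination -hab]
      ring
    exact Prod.ext e1 e2
  have hdis : Disjoint (F '' K) (Set.Iic β) := by
    rw [Set.disjoint_left]
    rintro _ ⟨φ, hφ, rfl⟩ hle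
    exact absurd hle.2 (not_le.2 (hne φ (fun z => ⟨hφ.1 z, hφ.2 z⟩) hle.1))
  obtain ⟨f, u, v, hu, huv, hv⟩ :=
    geometric_hahn_banach_compact_closed hKc hK (convex_Iic β) isClosed_Iic hdis
  have hf : ∀ x : ℝ × ℝ, f x = x.1 * f (1, 0) + x.2 * f (0, 1) := fun x => by
    have : x = x.1 • (1, 0) + x.2 • (0, 1) := by ext <;> simp
    conv_lhs => rw [this, map_add, map_smul, map_smul]
    rfl
  have hβ := hv β Set.self_mem_Iic
  -- `f` is bounded below on the quadrant, which recedes to infinity in every direction `-w`; this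
  -- fixes the signs of the multipliers.
  have key : ∀ w : ℝ × ℝ, 0 ≤ w → f w ≤ 0 := fun w hw => by
    by_contra! hpos
    obtain ⟨n, hn⟩ := exists_nat_gt ((f β - v) / f w)
    have := hv (β - (n : ℝ) • w) (sub_le_self _ (smul_nonneg n.cast_nonneg hw))
    rw [map_sub, map_smul, smul_eq_mul] at this
    rw [div_lt_iff₀ hpos] at hn
    linarith
  have ht := key (1, 0) ⟨zero_le_one, le_rfl⟩
  have hs := key (0, 1) ⟨le_rfl, zero_le_one⟩
  set t := -f (1, 0) with ht'
  set s := -f (0, 1) with hs'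
  have h1 := h s t (by linarith) (by linarith)
  -- The Neyman–Pearson test, which minimises `t` times the type-I error plus `s` times the type-II
  -- error.
  let φ : Z → ℝ := fun z => if 0 ≤ s * q z - t * p z then 1 else 0
  have hφ : φ ∈ K := by
    constructor <;> intro z <;> simp only [φ] <;> split_ifs <;> simp
  have h2 := hu _ ⟨φ, hφ, rfl⟩
  rw [hf] at h2 hβ
  have h3 : t * ∑ z, φ z * p z + s * ∑ z, (1 - φ z) * q z =
      s * ∑ z, q z - ∑ z, max 0 (s * q z - t * p z) := by
    rw [Finset.mul_sum, Finset.mul_sum, Finset.mul_sum, ← Finset.sum_add_distrib,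
      ← Finset.sum_sub_distrib]
    refine Finset.sum_congr rfl fun z _ => ?_
    simp only [φ]
    split_ifs with hz
    · rw [max_eq_right hz]; ring
    · rw [max_eq_left (not_le.1 hz).le]; ring
  simp only [F] at h2
  have e1 : f (1, 0) = -t := by simp [ht']
  have e2 : f (0, 1) = -s := by simp [hs']
  rw [e1, e2] at h2 hβ
  linarith

/-- Linear programming duality: the easy half is `φ u ≤ max 0 u` summed over outcomes, the other
half is the separation argument. -/
lemma testRegion_eq_supportRegion (hq : ∀ z, 0 ≤ q z) :
    testRegion p q = supportRegion (response p q hinge) := by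
  ext β
  simp only [testRegion, supportRegion, Set.mem_ofPred_eq, response_hinge_one_zero p hq,
    response_hinge_apply]
  refine and_congr_right fun _ => and_congr_right fun _ => and_congr_right fun _ => ⟨?_, fun h =>
    exists_test_of_forall_le β h⟩
  rintro ⟨φ, hφ, h1, h2⟩ s t hs ht
  have h3 : s * ∑ z, q z ≤ t * ∑ z, φ z * p z + s * ∑ z, (1 - φ z) * q z +
      ∑ z, max 0 (s * q z - t * p z) := by
    rw [Finset.mul_sum, Finset.mul_sum, Finset.mul_sum, ← Finset.sum_add_distrib,
      ← Finset.sum_add_distrib]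
    refine Finset.sum_le_sum fun z _ => ?_
    have := mul_le_mul_of_nonneg_left (le_max_right 0 (s * q z - t * p z)) (hφ z).1
    have := mul_le_of_le_one_left (le_max_left 0 (s * q z - t * p z)) (hφ z).2
    linarith
  have := mul_le_mul_of_nonneg_left h1 ht
  have := mul_le_mul_of_nonneg_left h2 hs
  linarith

/-- A test may be replaced by one that is at least as good as guessing. -/
lemma exists_test_le_sum (hp : ∀ z, 0 ≤ p z) (hq : ∀ z, 0 ≤ q z) (h : ∑ z, p z = ∑ z, q z)
    {φ : Z → ℝ} (hφ : ∀ z, 0 ≤ φ z ∧ φ z ≤ 1) :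
    ∃ ψ : Z → ℝ, (∀ z, 0 ≤ ψ z ∧ ψ z ≤ 1) ∧ ∑ z, ψ z * p z ≤ ∑ z, φ z * p z ∧
      ∑ z, (1 - ψ z) * q z ≤ ∑ z, (1 - φ z) * q z ∧
      ∑ z, ψ z * p z + ∑ z, (1 - ψ z) * q z ≤ ∑ z, q z := by
  by_cases hle : ∑ z, φ z * p z + ∑ z, (1 - φ z) * q z ≤ ∑ z, q z
  · exact ⟨φ, hφ, le_rfl, le_rfl, hle⟩
  have h1 : ∑ z, φ z * p z ≤ ∑ z, p z :=
    Finset.sum_le_sum fun z _ => mul_le_of_le_one_left (hp z) (hφ z).2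
  have h2 : ∑ z, (1 - φ z) * q z ≤ ∑ z, q z :=
    Finset.sum_le_sum fun z _ => mul_le_of_le_one_left (hq z) (by linarith [(hφ z).1])
  have h3 : 0 ≤ ∑ z, φ z * p z := Finset.sum_nonneg fun z _ => mul_nonneg (hφ z).1 (hp z)
  have hm : 0 < ∑ z, q z := by
    by_contra! hm
    linarith
  have hc : (∑ z, φ z * p z) / (∑ z, q z) * ∑ z, q z = ∑ z, φ z * p z := div_mul_cancel₀ _ hm.ne'
  -- Blind guessing with the same type-I error: its two errors add up exactly to the total mass.
  refine ⟨fun _ => (∑ z, φ z * p z) / ∑ z, q z, fun _ => ⟨by positivity, ?_⟩, ?_, ?_, ?_⟩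
  · rw [div_le_one hm]; linarith
  all_goals
    simp only [← Finset.mul_sum]
    simp only [h, sub_mul (1 : ℝ) (_ / _), one_mul, hc]
    linarith

/-- A test on a disjoint union is a pair of tests. To split a dominated pair `β`, both tests are
first moved into their own triangles, and the remaining slack is then shared between the summands
without leaving either triangle. -/
lemma testRegion_sumElim (hp : ∀ z, 0 ≤ p z) (hq : ∀ z, 0 ≤ q z) (h : ∑ z, p z = ∑ z, q z)
    (hp' : ∀ z, 0 ≤ p' z) (hq' : ∀ z, 0 ≤ q' z) (h' : ∑ z, p' z = ∑ z, q' z) :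
    testRegion (Sum.elim p p') (Sum.elim q q') = testRegion p q + testRegion p' q' := by
  ext β
  rw [Set.mem_add]
  constructor
  · rintro ⟨-, -, h3, φ, hφ, h4, h5⟩
    simp only [Fintype.sum_sum_type, Sum.elim_inl, Sum.elim_inr] at h3 h4 h5
    obtain ⟨ψ, hψ, a1, a2, a3⟩ := exists_test_le_sum hp hq h (φ := fun z => φ (Sum.inl z))
      fun z => hφ _
    obtain ⟨ψ', hψ', b1, b2, b3⟩ := exists_test_le_sum hp' hq' h' (φ := fun z => φ (Sum.inr z))
      fun z => hφ _
    have n1 : 0 ≤ ∑ z, ψ z * p z := Finset.sum_nonneg fun z _ => mul_nonneg (hψ z).1 (hp z)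
    have n2 : 0 ≤ ∑ z, (1 - ψ z) * q z :=
      Finset.sum_nonneg fun z _ => mul_nonneg (by linarith [(hψ z).2]) (hq z)
    have n3 : 0 ≤ ∑ z, ψ' z * p' z := Finset.sum_nonneg fun z _ => mul_nonneg (hψ' z).1 (hp' z)
    have n4 : 0 ≤ ∑ z, (1 - ψ' z) * q' z :=
      Finset.sum_nonneg fun z _ => mul_nonneg (by linarith [(hψ' z).2]) (hq' z)
    generalize hx : ∑ z, ψ z * p z = x at *
    generalize hy : ∑ z, (1 - ψ z) * q z = y at *
    generalize hx' : ∑ z, ψ' z * p' z = x' at *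
    generalize hy' : ∑ z, (1 - ψ' z) * q' z = y' at *
    generalize hm : ∑ z, q z = m at *
    generalize hm' : ∑ z, q' z = m' at *
    -- The share of the slack given to the first summand is proportional to its distance `m - x - y`
    -- from the hypotenuse. If both distances vanish there is no slack to share.
    obtain ⟨r, hr0, hr1, hr⟩ : ∃ r : ℝ, 0 ≤ r ∧ r ≤ 1 ∧
        r * (m + m' - x - y - x' - y') = m - x - y := by
      rcases eq_or_ne (m + m' - x - y - x' - y') 0 with h0 | h0
      · exact ⟨0, le_rfl, zero_le_one, by linarith⟩
      · have : 0 < m + m' - x - y - x' - y' := lt_of_le_of_ne (by linarith) h0.symm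
        refine ⟨(m - x - y) / (m + m' - x - y - x' - y'), div_nonneg (by linarith) this.le, ?_,
          div_mul_cancel₀ _ h0⟩
        rw [div_le_one this]; linarith
    have d1 : 0 ≤ β.1 - x - x' := by linarith
    have d2 : 0 ≤ β.2 - y - y' := by linarith
    have d3 : 0 ≤ m + m' - β.1 - β.2 := by linarith
    have c1 := mul_nonneg hr0 d1
    have c2 := mul_nonneg hr0 d2
    have c3 := mul_nonneg hr0 d3
    have c4 := mul_nonneg (sub_nonneg.2 hr1) d1
    have c5 := mul_nonneg (sub_nonneg.2 hr1) d2
    have c6 := mul_nonneg (sub_nonneg.2 hr1) d3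
    refine ⟨(x + r * (β.1 - x - x'), y + r * (β.2 - y - y')),
      ⟨by simp only; linarith, by simp only; linarith, by rw [hm]; simp only; linarith, ψ, hψ, ?_, ?_⟩,
      (x' + (1 - r) * (β.1 - x - x'), y' + (1 - r) * (β.2 - y - y')),
      ⟨by simp only; linarith, by simp only; linarith, by rw [hm']; simp only; linarith, ψ', hψ', ?_, ?_⟩,
      Prod.ext ?_ ?_⟩
    · rw [hx]; simp only; linarith
    · rw [hy]; simp only; linarith
    · rw [hx']; simp only; linarith
    · rw [hy']; simp only; linarith
    · simp only [Prod.fst_add]; ring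
    · simp only [Prod.snd_add]; ring
  · rintro ⟨b, ⟨a1, a2, a3, φ, hφ, a4, a5⟩, b', ⟨b1, b2, b3, φ', hφ', b4, b5⟩, rfl⟩
    refine ⟨add_nonneg a1 b1, add_nonneg a2 b2, ?_, Sum.elim φ φ', ?_, ?_, ?_⟩
    · simp only [Fintype.sum_sum_type, Sum.elim_inl, Sum.elim_inr, Prod.fst_add, Prod.snd_add]
      linarith
    · rintro (z | z)
      exacts [hφ z, hφ' z]
    · simpa using add_le_add a4 b4
    · simpa using add_le_add a5 b5

lemma testRegion_nonempty (hq : ∀ z, 0 ≤ q z) : (testRegion p q).Nonempty :=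
  ⟨(0, ∑ z, q z), le_rfl, Finset.sum_nonneg fun z _ => hq z, by simp, 0, fun z => by simp,
    by simp, by simp⟩

lemma testRegion_smul (hq : ∀ z, 0 ≤ q z) {w : ℝ} (hw : 0 ≤ w) :
    testRegion (w • p) (w • q) = w • testRegion p q := by
  rcases hw.eq_or_lt with rfl | hw
  · rw [Set.zero_smul_set (testRegion_nonempty hq)]
    ext β
    simp only [testRegion, zero_smul, Set.mem_ofPred_eq, Set.mem_zero, Pi.zero_apply, mul_zero,
      Finset.sum_const_zero]
    refine ⟨fun h => Prod.ext (by simp only [Prod.fst_zero]; linarith)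
      (by simp only [Prod.snd_zero]; linarith), ?_⟩
    rintro rfl
    exact ⟨le_rfl, le_rfl, by simp, 0, fun z => by simp, le_rfl, le_rfl⟩
  · ext β
    rw [Set.mem_smul_set_iff_inv_smul_mem₀ hw.ne']
    have e : ∀ a b : ℝ, w * a ≤ b ↔ a ≤ w⁻¹ * b := fun a b => by
      rw [← div_eq_inv_mul, le_div_iff₀ hw, mul_comm]
    have e' : ∀ a b : ℝ, b ≤ w * a ↔ w⁻¹ * b ≤ a := fun a b => by
      rw [← div_eq_inv_mul, div_le_iff₀ hw, mul_comm]
    have e0 : ∀ b : ℝ, 0 ≤ b ↔ 0 ≤ w⁻¹ * b := fun b => by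
      rw [← e]; simp
    simp only [testRegion, Set.mem_ofPred_eq, Pi.smul_apply, smul_eq_mul, Prod.smul_fst,
      Prod.smul_snd, mul_left_comm _ w, ← Finset.mul_sum, e, e', mul_add, ← e0]

end Finite

/-! ### Minkowski combinations of regions -/

/-- `h` is the profile of a finite test between two measures of the same total mass. -/
def IsProfile (h : ℝ × ℝ → ℝ) : Prop :=
  ∃ (Z : Type) (_ : Fintype Z) (p q : Z → ℝ), (∀ z, 0 ≤ p z) ∧ (∀ z, 0 ≤ q z) ∧
    ∑ z, p z = ∑ z, q z ∧ h = response p q hinge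

/-- The sum of two profiles is the profile of the disjoint union of the experiments. `IsProfile` is
returned as well so that longer sums can be built by induction. -/
lemma IsProfile.supportRegion_add {h h' : ℝ × ℝ → ℝ} (H : IsProfile h) (H' : IsProfile h') :
    IsProfile (h + h') ∧ supportRegion (h + h') = supportRegion h + supportRegion h' := by
  obtain ⟨Z, _, p, q, hp, hq, e, rfl⟩ := H
  obtain ⟨W, _, p', q', hp', hq', e', rfl⟩ := H'
  have hp'' : ∀ z, 0 ≤ Sum.elim p p' z := by rintro (z | z); exacts [hp z, hp' z]
  have hq'' : ∀ z, 0 ≤ Sum.elim q q' z := by rintro (z | z); exacts [hq z, hq' z]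
  have key : response p q hinge + response p' q' hinge =
      response (Sum.elim p p') (Sum.elim q q') hinge := by
    ext x
    simp [response_apply]
  rw [key]
  refine ⟨⟨Z ⊕ W, inferInstance, _, _, hp'', hq'', by simp [e, e'], rfl⟩, ?_⟩
  rw [← testRegion_eq_supportRegion hq, ← testRegion_eq_supportRegion hq',
    ← testRegion_eq_supportRegion hq'', testRegion_sumElim hp hq e hp' hq' e']

lemma hinge_smul {w : ℝ} (hw : 0 ≤ w) (x : ℝ × ℝ) : hinge (w • x) = w * hinge x := by
  simp [hinge, mul_max_of_nonneg _ _ hw, mul_sub]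

lemma IsProfile.supportRegion_smul {h : ℝ × ℝ → ℝ} (H : IsProfile h) {w : ℝ} (hw : 0 ≤ w) :
    IsProfile (w • h) ∧ supportRegion (w • h) = w • supportRegion h := by
  obtain ⟨Z, _, p, q, hp, hq, e, rfl⟩ := H
  have hp' : ∀ z, 0 ≤ (w • p) z := fun z => mul_nonneg hw (hp z)
  have hq' : ∀ z, 0 ≤ (w • q) z := fun z => mul_nonneg hw (hq z)
  have key : w • response p q hinge = response (w • p) (w • q) hinge := by
    ext x
    simp only [response_apply, Pi.smul_apply, smul_eq_mul, Finset.mul_sum, ← hinge_smul hw,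
      Prod.smul_mk, mul_left_comm]
  rw [key]
  refine ⟨⟨Z, inferInstance, _, _, hp', hq', by simp [← Finset.mul_sum, e], rfl⟩, ?_⟩
  rw [← testRegion_eq_supportRegion hq, ← testRegion_eq_supportRegion hq',
    testRegion_smul hq hw]

lemma isProfile_zero : IsProfile 0 :=
  ⟨Empty, inferInstance, Empty.elim, Empty.elim, nofun, nofun, rfl, by ext; simp [response_apply]⟩

lemma supportRegion_zero : supportRegion 0 = 0 := by
  ext β
  simp only [supportRegion, Pi.zero_apply, Set.mem_ofPred_eq, Set.mem_zero]
  refine ⟨fun h => Prod.ext (by simp only [Prod.fst_zero]; linarith)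
    (by simp only [Prod.snd_zero]; linarith), ?_⟩
  rintro rfl
  simp

lemma supportRegion_sum {ι : Type*} (J : Finset ι) {w : ι → ℝ} {h : ι → ℝ × ℝ → ℝ}
    (hw : ∀ j ∈ J, 0 ≤ w j) (H : ∀ j ∈ J, IsProfile (h j)) :
    IsProfile (∑ j ∈ J, w j • h j) ∧
      supportRegion (∑ j ∈ J, w j • h j) = ∑ j ∈ J, w j • supportRegion (h j) := by
  classical
  induction J using Finset.induction_on with
  | empty => exact ⟨by simpa using isProfile_zero, by simpa using supportRegion_zero⟩
  | insert j J hj ih =>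
    rw [Finset.forall_mem_insert] at hw H
    obtain ⟨i1, i2⟩ := ih hw.2 H.2
    obtain ⟨s1, s2⟩ := H.1.supportRegion_smul hw.1
    rw [Finset.sum_insert hj, Finset.sum_insert hj, ← i2, ← s2]
    exact s1.supportRegion_add i1

/-! ### Regions of pairs of measures -/

lemma integrable_test {Y : Type*} [MeasurableSpace Y] (P : Measure Y) [IsFiniteMeasure P]
    {φ : Y → ℝ} (hm : Measurable φ) (hφ : ∀ y, 0 ≤ φ y ∧ φ y ≤ 1) : Integrable φ P :=
  Integrable.of_bound hm.aestronglyMeasurable 1 <| .of_forall fun y => by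
    rw [Real.norm_of_nonneg (hφ y).1]; exact (hφ y).2

lemma integral_test_mem {Y : Type*} [MeasurableSpace Y] (P : Measure Y) [IsProbabilityMeasure P]
    {φ : Y → ℝ} (hm : Measurable φ) (hφ : ∀ y, 0 ≤ φ y ∧ φ y ≤ 1) :
    0 ≤ ∫ y, φ y ∂P ∧ ∫ y, φ y ∂P ≤ 1 := by
  refine ⟨integral_nonneg fun y => (hφ y).1, ?_⟩
  simpa using integral_mono (integrable_test P hm hφ) (integrable_const (1 : ℝ)) fun y => (hφ y).2

lemma integral_one_sub_test {Y : Type*} [MeasurableSpace Y] (P : Measure Y)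
    [IsProbabilityMeasure P] {φ : Y → ℝ} (hm : Measurable φ) (hφ : ∀ y, 0 ≤ φ y ∧ φ y ≤ 1) :
    ∫ y, (1 - φ y) ∂P = 1 - ∫ y, φ y ∂P := by
  rw [integral_sub (integrable_const _) (integrable_test P hm hφ)]
  simp

/-- Every test of `P` against `Q` has a gain that is bounded by `G`. -/
def DominatedBy {Y : Type*} [MeasurableSpace Y] (P Q : Measure Y) (G : ℝ × ℝ → ℝ) : Prop :=
  ∀ φ : Y → ℝ, Measurable φ → (∀ y, 0 ≤ φ y ∧ φ y ≤ 1) → ∀ s t, 0 ≤ s → 0 ≤ t →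
    s * ∫ y, φ y ∂Q - t * ∫ y, φ y ∂P ≤ G (s, t)

section General

variable {Y : Type u} [MeasurableSpace Y] {P Q : Measure Y}

lemma tradeoff_set_bddBelow (P Q : Measure Y) (t : ℝ) :
    0 ∈ lowerBounds ((fun φ : Y → ℝ => ∫ y, (1 - φ y) ∂Q) ''
      {φ : Y → ℝ | Measurable φ ∧ (∀ y, 0 ≤ φ y ∧ φ y ≤ 1) ∧ ∫ y, φ y ∂P ≤ t}) := by
  rintro _ ⟨φ, ⟨-, hφ, -⟩, rfl⟩
  exact integral_nonneg fun y => sub_nonneg.2 (hφ y).2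

lemma DominatedBy.privacyRegion_subset [IsProbabilityMeasure P] [IsProbabilityMeasure Q]
    {G : ℝ × ℝ → ℝ} (h : DominatedBy P Q G) (hG : G (1, 0) = 1) :
    privacyRegion P Q ⊆ supportRegion G := by
  rintro β ⟨h0, h1, h2, h3⟩
  have hne : ((fun φ : Y → ℝ => ∫ y, (1 - φ y) ∂Q) ''
      {φ : Y → ℝ | Measurable φ ∧ (∀ y, 0 ≤ φ y ∧ φ y ≤ 1) ∧ ∫ y, φ y ∂P ≤ β.1}).Nonempty :=
    ⟨_, 0, ⟨measurable_const, fun y => by simp, by simpa using h0⟩, rfl⟩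
  refine ⟨h0, (le_csInf hne (tradeoff_set_bddBelow P Q β.1)).trans h2, by rw [hG]; linarith,
    fun s t hs ht => ?_⟩
  rw [hG, mul_one]
  refine le_of_forall_pos_le_add fun e he => ?_
  -- The infimum need not be known to be attained. The tolerance `e / (s + 1)` costs at most `e`
  -- after multiplication by `s`, also when `s = 0`.
  obtain ⟨_, ⟨φ, ⟨hm, hφ, h5⟩, rfl⟩, h6⟩ := exists_lt_of_csInf_lt hne
    (b := β.2 + e / (s + 1)) (lt_of_le_of_lt h2 (lt_add_of_pos_right _ (by positivity)))
  simp only [integral_one_sub_test Q hm hφ] at h6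
  have h7 := h φ hm hφ s t hs ht
  have h8 := mul_le_mul_of_nonneg_left h5 ht
  have h9 := mul_le_mul_of_nonneg_left h6.le hs
  have h10 : s * (e / (s + 1)) ≤ e := by
    rw [← mul_div_assoc, div_le_iff₀ (by linarith)]
    nlinarith
  linarith

lemma DominatedBy.map {X : Type*} [MeasurableSpace X] {f : Y → X} (hf : Measurable f)
    {G : ℝ × ℝ → ℝ} (h : DominatedBy P Q G) : DominatedBy (P.map f) (Q.map f) G := by
  intro φ hm hφ s t hs ht
  rw [integral_map hf.aemeasurable hm.aestronglyMeasurable,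
    integral_map hf.aemeasurable hm.aestronglyMeasurable]
  exact h _ (hm.comp hf) (fun y => hφ _) s t hs ht

/-- The base case of the compositions: before any output is seen, the two hypotheses have the same
law. -/
lemma dominatedBy_hinge [IsProbabilityMeasure P] (h : P = Q) : DominatedBy P Q hinge := by
  intro φ hm hφ s t hs ht
  subst h
  obtain ⟨h0, h1⟩ := integral_test_mem P hm hφ
  rw [← sub_mul]
  rcases le_total 0 (s - t) with hst | hst
  · exact (mul_le_of_le_one_right hst h1).trans (le_max_right _ _)
  · exact (mul_nonpos_of_nonpos_of_nonneg hst h0).trans (le_max_left _ _)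

/-- Densities with respect to `P + Q` allow gains to be compared pointwise. Two functions `ψ`, `χ`
are needed because the conditional acceptance probability of a test differs under the two
hypotheses. -/
lemma exists_densities (P Q : Measure Y) [IsFiniteMeasure P] [IsFiniteMeasure Q] :
    ∃ (μ : Measure Y) (f g : Y → ℝ), Measurable f ∧ Measurable g ∧ (∀ y, 0 ≤ f y) ∧
      (∀ y, 0 ≤ g y) ∧
      ∀ ψ χ : Y → ℝ, Measurable ψ → (∀ y, 0 ≤ ψ y ∧ ψ y ≤ 1) → Measurable χ →
        (∀ y, 0 ≤ χ y ∧ χ y ≤ 1) → ∀ c d : ℝ,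
        Integrable (fun y => c * (g y * χ y) - d * (f y * ψ y)) μ ∧
        ∫ y, (c * (g y * χ y) - d * (f y * ψ y)) ∂μ = c * ∫ y, χ y ∂Q - d * ∫ y, ψ y ∂P := by
  set μ := P + Q
  have hP : P ≪ μ := Measure.absolutelyContinuous_of_le (Measure.le_add_right le_rfl)
  have hQ : Q ≪ μ := Measure.absolutelyContinuous_of_le (Measure.le_add_left le_rfl)
  set f : Y → ℝ := fun y => (P.rnDeriv μ y).toReal
  set g : Y → ℝ := fun y => (Q.rnDeriv μ y).toReal
  have eP : ∀ ψ : Y → ℝ, ∫ y, f y * ψ y ∂μ = ∫ y, ψ y ∂P := fun ψ =>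
    integral_toReal_rnDeriv_mul hP
  have eQ : ∀ ψ : Y → ℝ, ∫ y, g y * ψ y ∂μ = ∫ y, ψ y ∂Q := fun ψ =>
    integral_toReal_rnDeriv_mul hQ
  have iP : ∀ ψ : Y → ℝ, Measurable ψ → (∀ y, 0 ≤ ψ y ∧ ψ y ≤ 1) →
      Integrable (fun y => f y * ψ y) μ := fun ψ h1 h2 =>
    (integrable_toReal_rnDeriv_mul_iff hP).2 (integrable_test P h1 h2)
  have iQ : ∀ ψ : Y → ℝ, Measurable ψ → (∀ y, 0 ≤ ψ y ∧ ψ y ≤ 1) →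
      Integrable (fun y => g y * ψ y) μ := fun ψ h1 h2 =>
    (integrable_toReal_rnDeriv_mul_iff hQ).2 (integrable_test Q h1 h2)
  refine ⟨μ, f, g, (Measure.measurable_rnDeriv _ _).ennreal_toReal,
    (Measure.measurable_rnDeriv _ _).ennreal_toReal, fun _ => ENNReal.toReal_nonneg,
    fun _ => ENNReal.toReal_nonneg, fun ψ χ h1 h2 h3 h4 c d => ?_⟩
  have j1 := (iQ χ h3 h4).const_mul c
  have j2 := (iP ψ h1 h2).const_mul d
  refine ⟨j1.sub j2, ?_⟩
  rw [integral_sub j1 j2, integral_const_mul, integral_const_mul, eP, eQ]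

/-- Adding an observation whose conditional laws are dominated by a finite test. -/
theorem DominatedBy.compProd {X : Type*} [MeasurableSpace X] [IsFiniteMeasure P] [IsFiniteMeasure Q]
    {κ η : Kernel Y X} [IsMarkovKernel κ] [IsMarkovKernel η] {Z : Type*} [Fintype Z] {p q : Z → ℝ}
    (hp : ∀ z, 0 ≤ p z) (hq : ∀ z, 0 ≤ q z) {G : ℝ × ℝ → ℝ} (h : DominatedBy P Q G)
    (hκ : ∀ y, DominatedBy (κ y) (η y) (response p q hinge)) :
    DominatedBy (P ⊗ₘ κ) (Q ⊗ₘ η) (response p q G) := by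
  intro φ hm hφ s t hs ht
  rw [Measure.integral_compProd (integrable_test _ hm hφ),
    Measure.integral_compProd (integrable_test _ hm hφ), response_apply]
  set a : Y → ℝ := fun y => ∫ x, φ (y, x) ∂κ y
  set b : Y → ℝ := fun y => ∫ x, φ (y, x) ∂η y
  have hma : Measurable a := (hm.stronglyMeasurable.integral_kernel_prod_right' (κ := κ)).measurable
  have hmb : Measurable b := (hm.stronglyMeasurable.integral_kernel_prod_right' (κ := η)).measurable
  have hφ' : ∀ y, Measurable fun x => φ (y, x) := fun y => hm.comp measurable_prodMk_left
  have ha' : ∀ y, 0 ≤ a y ∧ a y ≤ 1 := fun y => integral_test_mem _ (hφ' y) fun x => hφ _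
  have hb' : ∀ y, 0 ≤ b y ∧ b y ≤ 1 := fun y => integral_test_mem _ (hφ' y) fun x => hφ _
  obtain ⟨μ, f, g, hmf, hmg, hf, hg, gain⟩ := exists_densities P Q
  classical
  -- The indicator of `S z` realises the `z`-th maximum pointwise, and it is itself a test of `P`
  -- against `Q`, with multipliers `s * q z` and `t * p z`.
  let S : Z → Set Y := fun z => {y | 0 ≤ s * q z * g y - t * p z * f y}
  have hS : ∀ z, MeasurableSet (S z) := fun z =>
    measurableSet_le measurable_const ((hmg.const_mul _).sub (hmf.const_mul _))
  let ψ : Z → Y → ℝ := fun z => (S z).indicator 1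
  have hψ : ∀ z, Measurable (ψ z) := fun z => measurable_one.indicator (hS z)
  have hψ' : ∀ z y, 0 ≤ ψ z y ∧ ψ z y ≤ 1 := fun z y => by
    simp only [ψ, Set.indicator_apply]
    split_ifs <;> simp
  -- The densities are absorbed into the multipliers, so the conditional bound is used at `(s * g y,
  -- t * f y)`.
  have step : ∀ y, s * (g y * b y) - t * (f y * a y) ≤
      ∑ z, (s * q z * (g y * ψ z y) - t * p z * (f y * ψ z y)) := fun y => by
    have := hκ y _ (hφ' y) (fun x => hφ _) (s * g y) (t * f y)
      (mul_nonneg hs (hg y)) (mul_nonneg ht (hf y))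
    rw [response_hinge_apply] at this
    calc _ = s * g y * b y - t * f y * a y := by ring
      _ ≤ _ := this
      _ = _ := Finset.sum_congr rfl fun z _ => by
        simp only [ψ, S, Set.indicator_apply, Set.mem_ofPred_eq, Pi.one_apply]
        split_ifs with hz
        · rw [max_eq_right (by linarith)]; ring
        · rw [max_eq_left (by linarith)]; ring
  have e := gain a b hma ha' hmb hb' s t
  rw [← e.2]
  refine (integral_mono e.1 (integrable_finsetSum _ fun z _ =>
    (gain (ψ z) (ψ z) (hψ z) (hψ' z) (hψ z) (hψ' z) (s * q z) (t * p z)).1) step).trans ?_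
  rw [integral_finsetSum _ fun z _ =>
    (gain (ψ z) (ψ z) (hψ z) (hψ' z) (hψ z) (hψ' z) (s * q z) (t * p z)).1]
  refine Finset.sum_le_sum fun z _ => ?_
  rw [(gain (ψ z) (ψ z) (hψ z) (hψ' z) (hψ z) (hψ' z) (s * q z) (t * p z)).2]
  exact h _ (hψ z) (hψ' z) _ _ (mul_nonneg hs (hq z)) (mul_nonneg ht (hp z))

/-- The finite test that belongs to a pair of measures on a finite set. -/
noncomputable def observe {Z : Type*} [Fintype Z] [MeasurableSpace Z] (P Q : Measure Z) :
    Module.End ℝ (ℝ × ℝ → ℝ) :=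
  response (fun z => P.real {z}) (fun z => Q.real {z})

lemma sum_real_singleton {Z : Type*} [Fintype Z] [MeasurableSpace Z] [MeasurableSingletonClass Z]
    (P : Measure Z) [IsProbabilityMeasure P] : ∑ z, P.real {z} = 1 := by
  simp

lemma integral_eq_sum_mul_real {Z : Type*} [Fintype Z] [MeasurableSpace Z]
    [MeasurableSingletonClass Z] (P : Measure Z) [IsFiniteMeasure P] (φ : Z → ℝ) :
    ∫ z, φ z ∂P = ∑ z, φ z * P.real {z} := by
  rw [integral_fintype .of_finite]
  simp [mul_comm]

lemma dominatedBy_observe {Z : Type*} [Fintype Z] [MeasurableSpace Z]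
    [MeasurableSingletonClass Z] (P Q : Measure Z) [IsFiniteMeasure P] [IsFiniteMeasure Q] :
    DominatedBy P Q (observe P Q hinge) := by
  intro φ hm hφ s t hs ht
  rw [integral_eq_sum_mul_real, integral_eq_sum_mul_real, observe, response_hinge_apply,
    Finset.mul_sum, Finset.mul_sum, ← Finset.sum_sub_distrib]
  refine Finset.sum_le_sum fun z _ => ?_
  have := mul_le_mul_of_nonneg_left (le_max_right 0 (s * Q.real {z} - t * P.real {z})) (hφ z).1
  have := mul_le_of_le_one_left (le_max_left 0 (s * Q.real {z} - t * P.real {z})) (hφ z).2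
  linarith

lemma observe_hinge_one_zero {Z : Type*} [Fintype Z] [MeasurableSpace Z]
    [MeasurableSingletonClass Z] (P Q : Measure Z) [IsProbabilityMeasure Q] :
    observe P Q hinge (1, 0) = 1 := by
  rw [observe, response_hinge_one_zero _ fun _ => measureReal_nonneg, sum_real_singleton]

/-- On a finite space domination by the profile is sharp, since duality supplies an actual test
below each pair. -/
lemma privacyRegion_eq_supportRegion [Fintype Y] [MeasurableSingletonClass Y]
    [IsProbabilityMeasure P] [IsProbabilityMeasure Q] :
    privacyRegion P Q = supportRegion (observe P Q hinge) := by
  apply Set.Subset.antisymm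
  · exact (dominatedBy_observe P Q).privacyRegion_subset (observe_hinge_one_zero P Q)
  · rw [observe, ← testRegion_eq_supportRegion fun _ => measureReal_nonneg]
    rintro β ⟨h0, h1, h2, φ, hφ, h3, h4⟩
    rw [sum_real_singleton] at h2
    refine ⟨h0, by linarith, ?_, by linarith⟩
    refine (csInf_le ⟨0, tradeoff_set_bddBelow P Q β.1⟩
      ⟨φ, ⟨measurable_of_finite φ, hφ, ?_⟩, rfl⟩).trans ?_
    · rwa [integral_eq_sum_mul_real]
    · simp only
      rwa [integral_eq_sum_mul_real]

end General

/-! ### Products -/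

section Products

variable {Z W : Type*} [Fintype Z] [Fintype W] [MeasurableSpace Z] [MeasurableSpace W]

lemma observe_prod (P Q : Measure Z) (P' Q' : Measure W) [SFinite P'] [SFinite Q'] :
    observe (P.prod P') (Q.prod Q') = observe P Q * observe P' Q' := by
  simp only [observe, response, Fintype.sum_prod_type, Finset.sum_mul_sum, scale_mul_scale,
    measureReal_def, ← Set.singleton_prod_singleton, Measure.prod_prod, ENNReal.toReal_mul]

lemma observe_pi (P Q : Measure Z) [SigmaFinite P] [SigmaFinite Q] (k : ℕ) :
    observe (Measure.pi fun _ : Fin k => P) (Measure.pi fun _ : Fin k => Q) =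
      observe P Q ^ k := by
  have h : ∀ (μ : Measure Z) [SigmaFinite μ] (k : ℕ) (f : Fin k → Z),
      (Measure.pi fun _ => μ).real {f} = ∏ i, μ.real {f i} := fun μ _ k f => by
    rw [measureReal_def, Measure.pi_singleton, ENNReal.toReal_prod]
    rfl
  simp only [observe, response, h]
  induction k with
  | zero => ext h x; simp
  | succ k ih =>
    rw [pow_succ', ← ih, ← (Fin.consEquiv fun _ => Z).sum_comp, Fintype.sum_prod_type,
      Finset.sum_mul_sum]
    simp [Fin.prod_univ_succ, scale_mul_scale, Fin.consEquiv]

/-- The split-off coordinate is placed second, to match `compProd` with a constant kernel. -/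
lemma kFold_succ {𝒟 : Type v} {Y : Type u} [MeasurableSpace Y] (M : 𝒟 → Measure Y) (k : ℕ) (d : 𝒟)
    [IsProbabilityMeasure (M d)] :
    kFold M (k + 1) d = ((kFold M k d).prod (M d)).map
      (fun x => (MeasurableEquiv.piFinSuccAbove (fun _ : Fin (k + 1) => Y) 0).symm (x.2, x.1)) := by
  have h := (measurePreserving_piFinSuccAbove (fun _ : Fin (k + 1) => M d) 0).symm
  have h' := h.comp (Measure.measurePreserving_swap (μ := Measure.pi fun _ : Fin k => M d)
    (ν := M d))
  exact h'.map_eq.symm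

end Products

/-! ### One mechanism with two constraints -/

section General

variable {Y : Type u} [MeasurableSpace Y] {P Q : Measure Y}

/-- Among randomized tests the worst one is the indicator of the set where the density of `Q` is at
least `e` times that of `P`. -/
lemma integral_test_le_of_forall_measure_le [IsFiniteMeasure P] [IsFiniteMeasure Q] {e δ : ℝ}
    (h : ∀ S, MeasurableSet S → Q.real S ≤ e * P.real S + δ) {φ : Y → ℝ} (hm : Measurable φ)
    (hφ : ∀ y, 0 ≤ φ y ∧ φ y ≤ 1) : ∫ y, φ y ∂Q ≤ e * ∫ y, φ y ∂P + δ := by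
  classical
  obtain ⟨μ, f, g, hmf, hmg, -, -, gain⟩ := exists_densities P Q
  let S : Set Y := {y | 0 ≤ g y - e * f y}
  have hS : MeasurableSet S := measurableSet_le measurable_const (hmg.sub (hmf.const_mul _))
  let ψ : Y → ℝ := S.indicator 1
  have hψ : Measurable ψ := measurable_one.indicator hS
  have hψ' : ∀ y, 0 ≤ ψ y ∧ ψ y ≤ 1 := fun y => by
    simp only [ψ, Set.indicator_apply]
    split_ifs <;> simp
  have e1 := gain φ φ hm hφ hm hφ 1 e
  have e2 := gain ψ ψ hψ hψ' hψ hψ' 1 e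
  have step := integral_mono e1.1 e2.1 fun y => by
    simp only [ψ, S, Set.indicator_apply, Set.mem_ofPred_eq, Pi.one_apply]
    split_ifs with hy
    · nlinarith [mul_nonneg hy (sub_nonneg.2 (hφ y).2)]
    · nlinarith [mul_nonneg (neg_nonneg.2 (not_le.1 hy).le) (hφ y).1]
  rw [e1.2, e2.2, integral_indicator_one hS, integral_indicator_one hS] at step
  linarith [h S hS]

end General

section Parameters

variable {ε₁ δ₁ ε₂ δ₂ δ α : ℝ}

lemma parameters_mem (hε : ε₂ ≤ ε₁) (hδ₁ : δ₁ ∈ Set.Icc (0 : ℝ) 1) (hδ₂ : δ₂ ∈ Set.Icc (0 : ℝ) 1)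
    (hδ : δ = revealProb δ₁ δ₂) (hα : α = mixWeight ε₁ δ₁ ε₂ δ₂) :
    0 ≤ δ ∧ δ ≤ 1 ∧ 0 ≤ α ∧ α ≤ 1 := by
  have h0 : 0 ≤ δ := hδ ▸ le_min hδ₁.1 hδ₂.1
  have h1 : δ ≤ 1 := hδ ▸ (min_le_left _ _).trans hδ₁.2
  have h2 : δ ≤ δ₂ := hδ ▸ min_le_right _ _
  rw [mixWeight, ← hδ] at hα
  refine ⟨h0, h1, ?_, ?_⟩
  · rw [hα]; linarith [min_le_left 1 (((δ₂ - δ) * (Real.exp ε₁ + 1)) /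
      ((1 - δ) * (Real.exp ε₁ - Real.exp ε₂)))]
  · have : 0 ≤ min 1 (((δ₂ - δ) * (Real.exp ε₁ + 1)) /
        ((1 - δ) * (Real.exp ε₁ - Real.exp ε₂))) := by
      refine le_min zero_le_one (div_nonneg (mul_nonneg (by linarith) (by positivity))
        (mul_nonneg (by linarith) (sub_nonneg.2 (Real.exp_le_exp.2 hε))))
    linarith

/-- The offset of the mixture at the slope `ε₂` is `δ + c`; the value of `c` in all cases. -/
lemma mixWeight_spec (hε : ε₂ ≤ ε₁) (hδ₁ : δ₁ ∈ Set.Icc (0 : ℝ) 1) (hδ : δ = revealProb δ₁ δ₂)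
    (hα : α = mixWeight ε₁ δ₁ ε₂ δ₂) :
    (1 - δ) * (1 - α) * (1 / (Real.exp ε₁ + 1)) * (Real.exp ε₁ - Real.exp ε₂) ≤ δ₂ - δ ∧
      ((1 - δ) * (1 - α) * (1 / (Real.exp ε₁ + 1)) * (Real.exp ε₁ - Real.exp ε₂) = δ₂ - δ ∨
        δ = 1 ∨ ε₁ = ε₂ ∨ (α = 0 ∧ δ = δ₁ ∧ ε₂ < ε₁)) := by
  have h1 : δ ≤ 1 := hδ ▸ (min_le_left _ _).trans hδ₁.2
  have h2 : δ ≤ δ₂ := hδ ▸ min_le_right _ _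
  -- For `δ = 1` or `ε₁ = ε₂` the quotient in `mixWeight` has denominator zero; the left side
  -- vanishes whatever `α` is.
  rcases h1.eq_or_lt with h1 | h1
  · exact ⟨by rw [h1] at h2 ⊢; linarith, .inr (.inl h1)⟩
  rcases hε.eq_or_lt with he | he
  · exact ⟨by rw [he]; linarith, .inr (.inr (.inl he.symm))⟩
  rw [mixWeight, ← hδ] at hα
  have hd : 0 < 1 - δ := by linarith
  have he' : 0 < Real.exp ε₁ - Real.exp ε₂ := sub_pos.2 (Real.exp_lt_exp.2 he)
  have hp : 0 < Real.exp ε₁ + 1 := by positivity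
  rcases le_total (((δ₂ - δ) * (Real.exp ε₁ + 1)) /
      ((1 - δ) * (Real.exp ε₁ - Real.exp ε₂))) 1 with hle | hle
  · have : (1 - δ) * (1 - α) * (1 / (Real.exp ε₁ + 1)) * (Real.exp ε₁ - Real.exp ε₂) =
        δ₂ - δ := by
      rw [hα, min_eq_right hle]
      field_simp
      ring
    exact ⟨this.le, .inl this⟩
  · have hα0 : α = 0 := by rw [hα, min_eq_left hle, sub_self]
    rw [one_le_div (mul_pos hd he')] at hle
    refine ⟨?_, .inr (.inr (.inr ⟨hα0, ?_, he⟩))⟩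
    · rw [hα0, sub_zero, mul_one, mul_one_div, div_mul_eq_mul_div, div_le_iff₀ hp]
      exact hle
    -- If the minimum were `δ₂`, the numerator of the quotient would be zero, against `hle`.
    · rcases min_choice δ₁ δ₂ with h | h
      · exact hδ.trans h
      · have : δ = δ₂ := hδ.trans h
        rw [this, sub_self, zero_mul] at hle
        rw [this] at hd
        exact absurd hle (not_le.2 (mul_pos hd he'))

end Parameters

/-! ### Masses -/

lemma ofMasses_real_singleton {n : ℕ} {p : Fin n → ℝ} (hp : ∀ i, 0 ≤ p i) (i : Fin n) :
    (ofMasses p).real {i} = p i := by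
  rw [measureReal_def, ofMasses, Measure.finsetSum_apply]
  simp only [Measure.smul_apply, smul_eq_mul, Measure.dirac_apply, Set.indicator_apply,
    Set.mem_singleton_iff, Pi.one_apply, mul_ite, mul_one, mul_zero, Finset.sum_ite_eq',
    Finset.mem_univ, if_true, ENNReal.toReal_ofReal (hp i)]

lemma isProbabilityMeasure_ofMasses {n : ℕ} {p : Fin n → ℝ} (hp : ∀ i, 0 ≤ p i)
    (h : ∑ i, p i = 1) : IsProbabilityMeasure (ofMasses p) := by
  constructor
  simp [ofMasses, ← ENNReal.ofReal_sum_of_nonneg fun i _ => hp i, h]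

lemma observe_ofMasses {n : ℕ} {p q : Fin n → ℝ} (hp : ∀ i, 0 ≤ p i) (hq : ∀ i, 0 ≤ q i) :
    observe (ofMasses p) (ofMasses q) = response p q := by
  simp only [observe, ofMasses_real_singleton hp, ofMasses_real_singleton hq]

section RandomizedResponse

instance (ε : ℝ) (b : Bool) : IsProbabilityMeasure (randomizedResponse ε b) := by
  cases b <;> refine isProbabilityMeasure_ofMasses ?_ ?_
  · intro i; fin_cases i <;> simp <;> positivity
  · simp; field_simp
  · intro i; fin_cases i <;> simp <;> positivity
  · simp; field_simp; ring

lemma observe_randomizedResponse (ε : ℝ) :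
    observe (randomizedResponse ε false) (randomizedResponse ε true) =
      scale (1 / (Real.exp ε + 1)) (Real.exp ε / (Real.exp ε + 1)) +
      scale (Real.exp ε / (Real.exp ε + 1)) (1 / (Real.exp ε + 1)) := by
  rw [randomizedResponse, randomizedResponse, observe_ofMasses]
  · simp [response]
  all_goals intro i; fin_cases i <;> simp <;> positivity

end RandomizedResponse

section Mixture

variable {ε₁ ε₂ δ α : ℝ}

lemma mixture_masses_nonneg (hδ' : δ ≤ 1) (hα : 0 ≤ α) (hα' : α ≤ 1) :
    0 ≤ (1 - δ) * (1 - α) * (1 / (Real.exp ε₁ + 1)) ∧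
    0 ≤ (1 - δ) * (1 - α) * (Real.exp ε₁ / (Real.exp ε₁ + 1)) ∧
    0 ≤ (1 - δ) * α * (1 / (Real.exp ε₂ + 1)) ∧
    0 ≤ (1 - δ) * α * (Real.exp ε₂ / (Real.exp ε₂ + 1)) := by
  have h1 : 0 ≤ 1 - δ := by linarith
  have h2 : 0 ≤ 1 - α := by linarith
  refine ⟨?_, ?_, ?_, ?_⟩ <;> positivity

lemma isProbabilityMeasure_mixture (hδ : 0 ≤ δ) (hδ' : δ ≤ 1) (hα : 0 ≤ α) (hα' : α ≤ 1)
    (b : Bool) : IsProbabilityMeasure (mixture ε₁ ε₂ δ α b) := by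
  obtain ⟨h1, h2, h3, h4⟩ := mixture_masses_nonneg (ε₁ := ε₁) (ε₂ := ε₂) hδ' hα hα'
  cases b <;> refine isProbabilityMeasure_ofMasses ?_ ?_
  · intro i; fin_cases i <;> first | assumption | exact le_rfl
  · simp [Fin.sum_univ_six]; field_simp; ring
  · intro i; fin_cases i <;> first | assumption | exact le_rfl
  · simp [Fin.sum_univ_six]; field_simp; ring

lemma observe_mixture (hδ : 0 ≤ δ) (hδ' : δ ≤ 1) (hα : 0 ≤ α) (hα' : α ≤ 1) :
    observe (mixture ε₁ ε₂ δ α false) (mixture ε₁ ε₂ δ α true) =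
      scale 0 δ +
      scale ((1 - δ) * (1 - α) * (1 / (Real.exp ε₁ + 1)))
        ((1 - δ) * (1 - α) * (Real.exp ε₁ / (Real.exp ε₁ + 1))) +
      scale ((1 - δ) * α * (1 / (Real.exp ε₂ + 1)))
        ((1 - δ) * α * (Real.exp ε₂ / (Real.exp ε₂ + 1))) +
      scale ((1 - δ) * α * (Real.exp ε₂ / (Real.exp ε₂ + 1)))
        ((1 - δ) * α * (1 / (Real.exp ε₂ + 1))) +
      scale ((1 - δ) * (1 - α) * (Real.exp ε₁ / (Real.exp ε₁ + 1)))
        ((1 - δ) * (1 - α) * (1 / (Real.exp ε₁ + 1))) +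
      scale δ 0 := by
  obtain ⟨h1, h2, h3, h4⟩ := mixture_masses_nonneg (ε₁ := ε₁) (ε₂ := ε₂) hδ' hα hα'
  rw [mixture, mixture, observe_ofMasses]
  · simp [response, Fin.sum_univ_six]
  all_goals intro i; fin_cases i <;> first | assumption | exact le_rfl

/-- The gain of the mixture, with `m₁`, `m₂` the masses of the less likely outputs. -/
lemma observe_mixture_hinge {s t : ℝ} (hs : 0 ≤ s) (ht : 0 ≤ t) (hδ : 0 ≤ δ) (hδ' : δ ≤ 1)
    (hα : 0 ≤ α) (hα' : α ≤ 1) {m₁ m₂ : ℝ} (hm₁ : m₁ = (1 - δ) * (1 - α) * (1 / (Real.exp ε₁ + 1)))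
    (hm₂ : m₂ = (1 - δ) * α * (1 / (Real.exp ε₂ + 1))) :
    observe (mixture ε₁ ε₂ δ α false) (mixture ε₁ ε₂ δ α true) hinge (s, t) =
      s * δ + m₁ * (max 0 (s - t * Real.exp ε₁) + max 0 (s * Real.exp ε₁ - t)) +
        m₂ * (max 0 (s - t * Real.exp ε₂) + max 0 (s * Real.exp ε₂ - t)) := by
  obtain ⟨h1, -, h3, -⟩ := mixture_masses_nonneg (ε₁ := ε₁) (ε₂ := ε₂) hδ' hα hα'
  have e1 : (1 - δ) * (1 - α) * (Real.exp ε₁ / (Real.exp ε₁ + 1)) = m₁ * Real.exp ε₁ := by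
    rw [hm₁]; ring
  have e2 : (1 - δ) * α * (Real.exp ε₂ / (Real.exp ε₂ + 1)) = m₂ * Real.exp ε₂ := by
    rw [hm₂]; ring
  rw [← hm₁] at h1
  rw [← hm₂] at h3
  rw [observe_mixture hδ hδ' hα hα', e1, e2, ← hm₁, ← hm₂]
  simp only [LinearMap.add_apply, Pi.add_apply, scale_apply, hinge, mul_zero, zero_sub, sub_zero,
    mul_add, mul_max_of_nonneg _ _ h1, mul_max_of_nonneg _ _ h3]
  rw [max_eq_left (by have := mul_nonneg ht hδ; linarith), max_eq_right (mul_nonneg hs hδ)]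
  ring_nf

end Mixture

section TwoConstraints

variable {ε₁ δ₁ ε₂ δ₂ δ α : ℝ}

/-- Any pair of test errors allowed by both constraints satisfies the constraints of the mixture. -/
lemma gain_le_observe_mixture (hε₂ : 0 ≤ ε₂) (hε : ε₂ ≤ ε₁) (hδ₁ : δ₁ ∈ Set.Icc (0 : ℝ) 1)
    (hδ₂ : δ₂ ∈ Set.Icc (0 : ℝ) 1) (hδ : δ = revealProb δ₁ δ₂)
    (hα : α = mixWeight ε₁ δ₁ ε₂ δ₂) {x y : ℝ} (hx : 0 ≤ x) (hy' : y ≤ 1)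
    (h1 : y ≤ Real.exp ε₁ * x + δ₁) (h2 : y ≤ Real.exp ε₂ * x + δ₂)
    (h3 : 1 - x ≤ Real.exp ε₁ * (1 - y) + δ₁) (h4 : 1 - x ≤ Real.exp ε₂ * (1 - y) + δ₂)
    {s t : ℝ} (hs : 0 ≤ s) (ht : 0 ≤ t) :
    s * y - t * x ≤
      observe (mixture ε₁ ε₂ δ α false) (mixture ε₁ ε₂ δ α true) hinge (s, t) := by
  obtain ⟨d0, d1, a0, a1⟩ := parameters_mem hε hδ₁ hδ₂ hδ hα
  obtain ⟨-, hc⟩ := mixWeight_spec hε hδ₁ hδ hα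
  obtain ⟨n1, -, n2, -⟩ := mixture_masses_nonneg (ε₁ := ε₁) (ε₂ := ε₂) d1 a0 a1
  rw [observe_mixture_hinge hs ht d0 d1 a0 a1 rfl rfl]
  have ha1 : 1 ≤ Real.exp ε₂ := Real.one_le_exp hε₂
  have hab : Real.exp ε₂ ≤ Real.exp ε₁ := Real.exp_le_exp.2 hε
  have hlt : ε₂ < ε₁ → Real.exp ε₂ < Real.exp ε₁ := Real.exp_lt_exp.2
  have heq : ε₁ = ε₂ → Real.exp ε₁ = Real.exp ε₂ := congrArg _
  have hm : (1 - δ) * (1 - α) * (1 / (Real.exp ε₁ + 1)) * (Real.exp ε₁ + 1) +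
      (1 - δ) * α * (1 / (Real.exp ε₂ + 1)) * (Real.exp ε₂ + 1) = 1 - δ := by
    field_simp; ring
  have hm0 : α = 0 →
      (1 - δ) * (1 - α) * (1 / (Real.exp ε₁ + 1)) * (Real.exp ε₁ + 1) = 1 - δ := by
    rintro rfl
    field_simp; ring
  generalize (1 - δ) * (1 - α) * (1 / (Real.exp ε₁ + 1)) = m at *
  generalize (1 - δ) * α * (1 / (Real.exp ε₂ + 1)) = n at *
  generalize Real.exp ε₁ = a at *
  generalize Real.exp ε₂ = b at *
  have hδ' : ∀ u v : ℝ, u ≤ v + δ₁ → u ≤ v + δ₂ → u ≤ v + δ := fun u v h h' => by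
    rw [hδ, revealProb, ← min_add_add_left]
    exact le_min h h'
  -- Since `b ≤ a`, the second constraint also holds with slope `a`, so the smaller offset is
  -- available there.
  have I4 : y ≤ a * x + δ := hδ' _ _ h1 (h2.trans (by nlinarith))
  have I1 : 1 - x ≤ a * (1 - y) + δ := hδ' _ _ h3 (h4.trans (by nlinarith))
  have hmab : 0 ≤ m * (a - b) := mul_nonneg n1 (by linarith)
  -- The offset of the mixture at slope `b` is `δ + m * (a - b)`, which equals `δ₂` unless a
  -- degenerate case occurs.
  have I23 : y ≤ b * x + (δ + m * (a - b)) ∧ 1 - x ≤ b * (1 - y) + (δ + m * (a - b)) := by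
    rcases hc with hc | hc | hc | ⟨hc, -, hc'⟩
    · rw [hc]
      exact ⟨by linarith, by linarith⟩
    · constructor <;> nlinarith
    · rw [heq hc] at I4 I1 hmab
      rw [heq hc]
      exact ⟨by linarith, by linarith⟩
    -- Here `α = 0`: the bounds of slope `b` follow from those of slope `a`, combined with weights
    -- `(a * b - 1) / (a ^ 2 - 1)` and `(a - b) / (a ^ 2 - 1)`.
    · have hba := hlt hc'
      have ha : 0 < a ^ 2 - 1 := by nlinarith
      have hm' := hm0 hc
      have k1 : 0 ≤ a - b := by linarith
      have k2 : 0 ≤ a * b - 1 := by nlinarith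
      have e : (δ + m * (a - b)) * (a ^ 2 - 1) =
          (a * b - 1) * δ + (a - b) * (a - 1 + δ) := by
        linear_combination (a - b) * (a - 1) * hm'
      constructor
      · rw [← sub_le_iff_le_add', ← mul_le_mul_iff_left₀ ha, e]
        have := mul_le_mul_of_nonneg_left I4 k2
        have := mul_le_mul_of_nonneg_left I1 k1
        linarith
      · rw [← sub_le_iff_le_add', ← mul_le_mul_iff_left₀ ha, e]
        have := mul_le_mul_of_nonneg_left I4 k1
        have := mul_le_mul_of_nonneg_left I1 k2
        linarith
  obtain ⟨I3, I2⟩ := I23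
  have b0 : 0 < b := by linarith
  have a0' : 0 < a := by linarith
  have M1 := mul_le_mul_of_nonneg_left (le_max_left 0 (s - t * a)) n1
  have M2 := mul_le_mul_of_nonneg_left (le_max_right 0 (s - t * a)) n1
  have M3 := mul_le_mul_of_nonneg_left (le_max_left 0 (s * a - t)) n1
  have M4 := mul_le_mul_of_nonneg_left (le_max_right 0 (s * a - t)) n1
  have N1 := mul_le_mul_of_nonneg_left (le_max_left 0 (s - t * b)) n2
  have N2 := mul_le_mul_of_nonneg_left (le_max_right 0 (s - t * b)) n2
  have N3 := mul_le_mul_of_nonneg_left (le_max_left 0 (s * b - t)) n2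
  have N4 := mul_le_mul_of_nonneg_left (le_max_right 0 (s * b - t)) n2
  -- The edges `I1`, `I2`, `I3`, `I4` belong to `s / t = a, b, 1 / b, 1 / a`. Between consecutive
  -- ratios the objective is a nonnegative combination of the two adjacent edges; beyond the ends `y
  -- ≤ 1` or `0 ≤ x` is the second one. The weights have denominators `a - b` or `b ^ 2 - 1`, so
  -- equality cases are split off.
  rcases le_total (t * a) s with c1 | c1
  · have := mul_le_mul_of_nonneg_left I1 ht
    have := mul_nonneg (sub_nonneg.2 c1) (sub_nonneg.2 hy')
    have : (s - t) * (m * (a + 1) + n * (b + 1)) = (s - t) * (1 - δ) := by rw [hm]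
    linarith
  rcases le_total (t * b) s with c2 | c2
  · rcases hab.eq_or_lt with hab | hab
    · subst hab
      obtain rfl : s = t * b := le_antisymm c1 c2
      have := mul_le_mul_of_nonneg_left I1 ht
      have : (t * b - t) * (m * (b + 1) + n * (b + 1)) = (t * b - t) * (1 - δ) := by rw [hm]
      linarith
    have k := sub_pos.2 hab
    have lower : s * δ + m * (s * a - t) + n * (s - t * b + (s * b - t)) ≤
      s * δ + m * (max 0 (s - t * a) + max 0 (s * a - t)) +
        n * (max 0 (s - t * b) + max 0 (s * b - t)) := by linarith
    refine le_trans ?_ lower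
    rw [← mul_le_mul_iff_left₀ k]
    have := mul_le_mul_of_nonneg_left I1 (sub_nonneg.2 c2)
    have := mul_le_mul_of_nonneg_left I2 (sub_nonneg.2 c1)
    have : (a - b) * (s - t) * (m * (a + 1) + n * (b + 1)) = (a - b) * (s - t) * (1 - δ) := by
      rw [hm]
    linarith
  rcases le_total t (s * b) with c3 | c3
  · have lower : s * δ + m * (s * a - t) + n * (s * b - t) ≤
      s * δ + m * (max 0 (s - t * a) + max 0 (s * a - t)) +
        n * (max 0 (s - t * b) + max 0 (s * b - t)) := by linarith
    refine le_trans ?_ lower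
    rcases ha1.eq_or_lt with hb | hb
    · subst hb
      obtain rfl : s = t := by linarith
      have := mul_le_mul_of_nonneg_left I3 hs
      linarith
    have k : 0 < b ^ 2 - 1 := by nlinarith
    rw [← mul_le_mul_iff_left₀ k]
    have := mul_le_mul_of_nonneg_left I3 (sub_nonneg.2 c2)
    have := mul_le_mul_of_nonneg_left I2 (sub_nonneg.2 c3)
    have : (s * b - t) * (b - 1) * (m * (a + 1) + n * (b + 1)) =
      (s * b - t) * (b - 1) * (1 - δ) := by rw [hm]
    linarith
  rcases le_total t (s * a) with c4 | c4
  · have lower : s * δ + m * (s * a - t) ≤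
      s * δ + m * (max 0 (s - t * a) + max 0 (s * a - t)) +
        n * (max 0 (s - t * b) + max 0 (s * b - t)) := by linarith
    refine le_trans ?_ lower
    rcases hab.eq_or_lt with hab | hab
    · subst hab
      obtain rfl : t = s * b := le_antisymm c4 c3
      have := mul_le_mul_of_nonneg_left I3 hs
      linarith
    have k := sub_pos.2 hab
    rw [← mul_le_mul_iff_left₀ k]
    have := mul_le_mul_of_nonneg_left I3 (sub_nonneg.2 c4)
    have := mul_le_mul_of_nonneg_left I4 (sub_nonneg.2 c3)
    linarith
  · have := mul_le_mul_of_nonneg_left I4 hs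
    have := mul_le_mul_of_nonneg_right c4 hx
    linarith

end TwoConstraints

instance {𝒟 : Type v} {Y : Type u} [MeasurableSpace Y] (M : 𝒟 → Measure Y) (k : ℕ) (d : 𝒟)
    [IsProbabilityMeasure (M d)] : IsProbabilityMeasure (kFold M k d) :=
  inferInstanceAs (IsProbabilityMeasure (Measure.pi fun _ => M d))

/-! ### The mixture satisfies both constraints -/

/-- One direction is the gain of the indicator of `S`, the other that of its complement with the
multipliers exchanged. -/
lemma isDP_bool_of_gain {Z : Type*} [Fintype Z] [MeasurableSpace Z] [MeasurableSingletonClass Z]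
    {M : Bool → Measure Z} [∀ b, IsProbabilityMeasure (M b)] {ε δ : ℝ}
    (h1 : observe (M false) (M true) hinge (1, Real.exp ε) ≤ δ)
    (h2 : observe (M false) (M true) hinge (Real.exp ε, 1) ≤ Real.exp ε - 1 + δ) :
    IsDP (fun b b' : Bool => b ≠ b') M ε δ := by
  have key : ∀ S : Set Z, MeasurableSet S → ∀ s t, 0 ≤ s → 0 ≤ t →
      s * (M true).real S - t * (M false).real S ≤ observe (M false) (M true) hinge (s, t) := by
    intro S hS s t hs ht
    have := dominatedBy_observe (M false) (M true) (S.indicator 1) (measurable_one.indicator hS)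
      (fun y => ⟨Set.indicator_nonneg (fun _ _ => zero_le_one) _,
        Set.indicator_le_self' (fun _ _ => zero_le_one) _⟩) s t hs ht
    rwa [integral_indicator_one hS, integral_indicator_one hS] at this
  intro d d' hd S hS
  cases d <;> cases d'
  · exact absurd rfl hd
  · have := key Sᶜ hS.compl _ 1 (Real.exp_pos ε).le zero_le_one
    rw [probReal_compl_eq_one_sub hS, probReal_compl_eq_one_sub hS] at this
    linarith
  · have := key S hS 1 _ zero_le_one (Real.exp_pos ε).le
    linarith
  · exact absurd rfl hd

section TwoConstraints

variable {ε₁ δ₁ ε₂ δ₂ δ α : ℝ}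

/-- At slope `ε₁` only the revealing output contributes, giving `δ`. At slope `ε₂` one output of the
`ε₁`-response is added, and `mixWeight_spec` bounds the total by `δ₂`. -/
lemma isDP_mixture (hε₂ : 0 ≤ ε₂) (hε : ε₂ ≤ ε₁) (hδ₁ : δ₁ ∈ Set.Icc (0 : ℝ) 1)
    (hδ₂ : δ₂ ∈ Set.Icc (0 : ℝ) 1) (hδ : δ = revealProb δ₁ δ₂)
    (hα : α = mixWeight ε₁ δ₁ ε₂ δ₂) :
    IsDP (fun b b' : Bool => b ≠ b') (mixture ε₁ ε₂ δ α) ε₁ δ₁ ∧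
      IsDP (fun b b' : Bool => b ≠ b') (mixture ε₁ ε₂ δ α) ε₂ δ₂ := by
  obtain ⟨d0, d1, a0, a1⟩ := parameters_mem hε hδ₁ hδ₂ hδ hα
  obtain ⟨hc, -⟩ := mixWeight_spec hε hδ₁ hδ hα
  have hle : δ ≤ δ₁ := hδ ▸ min_le_left _ _
  have := isProbabilityMeasure_mixture (ε₁ := ε₁) (ε₂ := ε₂) d0 d1 a0 a1
  have ha1 : 1 ≤ Real.exp ε₂ := Real.one_le_exp hε₂
  have hab : Real.exp ε₂ ≤ Real.exp ε₁ := Real.exp_le_exp.2 hε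
  have hm : (1 - δ) * (1 - α) * (1 / (Real.exp ε₁ + 1)) * (Real.exp ε₁ + 1) +
      (1 - δ) * α * (1 / (Real.exp ε₂ + 1)) * (Real.exp ε₂ + 1) = 1 - δ := by
    field_simp; ring
  constructor <;> apply isDP_bool_of_gain <;>
    rw [observe_mixture_hinge (by positivity) (by positivity) d0 d1 a0 a1 rfl rfl]
  all_goals
    generalize (1 - δ) * (1 - α) * (1 / (Real.exp ε₁ + 1)) = m at *
    generalize (1 - δ) * α * (1 / (Real.exp ε₂ + 1)) = n at *
    generalize Real.exp ε₁ = a at *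
    generalize Real.exp ε₂ = b at *
  · rw [max_eq_left (by nlinarith), max_eq_left (by linarith), max_eq_left (by nlinarith),
      max_eq_left (by linarith)]
    linarith
  · rw [max_eq_right (by linarith), max_eq_right (by nlinarith), max_eq_right (by linarith),
      max_eq_right (by nlinarith)]
    have : (a - 1) * (m * (a + 1) + n * (b + 1)) = (a - 1) * (1 - δ) := by rw [hm]
    linarith
  · rw [max_eq_left (by nlinarith), max_eq_right (by linarith), max_eq_left (by nlinarith),
      max_eq_left (by linarith)]
    linarith
  · rw [max_eq_left (by linarith), max_eq_right (by nlinarith), max_eq_right (by linarith),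
      max_eq_right (by nlinarith)]
    have : (b - 1) * (m * (a + 1) + n * (b + 1)) = (b - 1) * (1 - δ) := by rw [hm]
    linarith

/-- A pair of output laws allowed by both constraints is dominated by the mixture. -/
lemma dominatedBy_mixture (hε₂ : 0 ≤ ε₂) (hε : ε₂ ≤ ε₁) (hδ₁ : δ₁ ∈ Set.Icc (0 : ℝ) 1)
    (hδ₂ : δ₂ ∈ Set.Icc (0 : ℝ) 1) (hδ : δ = revealProb δ₁ δ₂)
    (hα : α = mixWeight ε₁ δ₁ ε₂ δ₂) {𝒟 : Type v} {adj : 𝒟 → 𝒟 → Prop} {Y : Type u}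
    [MeasurableSpace Y] {M : 𝒟 → Measure Y} [∀ d, IsProbabilityMeasure (M d)]
    (hsymm : ∀ d d', adj d d' → adj d' d) (h1 : IsDP adj M ε₁ δ₁) (h2 : IsDP adj M ε₂ δ₂)
    {d₀ d₁ : 𝒟} (had : adj d₀ d₁) :
    DominatedBy (M d₀) (M d₁)
      (observe (mixture ε₁ ε₂ δ α false) (mixture ε₁ ε₂ δ α true) hinge) := by
  intro φ hm hφ s t hs ht
  have hm' : Measurable fun y => 1 - φ y := measurable_const.sub hm
  have hφ' : ∀ y, 0 ≤ 1 - φ y ∧ 1 - φ y ≤ 1 := fun y =>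
    ⟨sub_nonneg.2 (hφ y).2, sub_le_self _ (hφ y).1⟩
  have had' := hsymm _ _ had
  have k1 := integral_test_le_of_forall_measure_le (h1 _ _ had') hm hφ
  have k2 := integral_test_le_of_forall_measure_le (h2 _ _ had') hm hφ
  have k3 := integral_test_le_of_forall_measure_le (h1 _ _ had) hm' hφ'
  have k4 := integral_test_le_of_forall_measure_le (h2 _ _ had) hm' hφ'
  rw [integral_one_sub_test _ hm hφ, integral_one_sub_test _ hm hφ] at k3 k4
  exact gain_le_observe_mixture hε₂ hε hδ₁ hδ₂ hδ hα (integral_test_mem _ hm hφ).1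
    (integral_test_mem _ hm hφ).2 k1 k2 k3 k4 hs ht

end TwoConstraints

/-! ### Compositions are dominated by the composed mixture -/

lemma DominatedBy.kFold {𝒟 : Type v} {Y : Type u} [MeasurableSpace Y] {M : 𝒟 → Measure Y}
    [∀ d, IsProbabilityMeasure (M d)] {d₀ d₁ : 𝒟} {Z : Type*} [Fintype Z] [MeasurableSpace Z]
    {P Q : Measure Z} (h : DominatedBy (M d₀) (M d₁) (observe P Q hinge)) (k : ℕ) :
    DominatedBy (kFold M k d₀) (kFold M k d₁) ((observe P Q ^ k) hinge) := by
  induction k with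
  | zero =>
    refine dominatedBy_hinge ?_
    rw [DoubleDP.kFold, DoubleDP.kFold, Measure.pi_of_empty _ default,
      Measure.pi_of_empty _ default]
  | succ k ih =>
    rw [kFold_succ, kFold_succ, pow_succ', Module.End.mul_apply, ← Measure.compProd_const,
      ← Measure.compProd_const]
    exact (ih.compProd (fun _ => measureReal_nonneg) (fun _ => measureReal_nonneg)
      fun _ => h).map (by fun_prop)

namespace AdaptiveComposition

variable {𝒟 : Type v} {R : Type u} {Y : ℕ → Type u} [MeasurableSpace R]
  [∀ n, MeasurableSpace (Y n)] (A : AdaptiveComposition 𝒟 R Y)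

instance (b : Bool) (n : ℕ) : IsMarkovKernel (A.step b n) :=
  ⟨fun h => A.isProbabilityMeasure_mech n h _⟩

instance isProbabilityMeasure_law (b : Bool) : ∀ n, IsProbabilityMeasure (A.law b n)
  | 0 => A.isProbabilityMeasure_coins
  | n + 1 => by
    have := isProbabilityMeasure_law b n
    exact inferInstanceAs (IsProbabilityMeasure (A.law b n ⊗ₘ A.step b n))

/-- `DominatedBy.compProd` only asks for a bound that is uniform over transcripts, so adaptive
choices are harmless. -/
lemma dominatedBy_law {Z : Type*} [Fintype Z] [MeasurableSpace Z] {P Q : Measure Z} {k : ℕ}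
    (h : ∀ n < k, ∀ x, DominatedBy (A.step false n x) (A.step true n x) (observe P Q hinge)) :
    DominatedBy (A.law false k) (A.law true k) ((observe P Q ^ k) hinge) := by
  induction k with
  | zero =>
    have := A.isProbabilityMeasure_coins
    exact dominatedBy_hinge (P := A.coins) rfl
  | succ k ih =>
    rw [pow_succ', Module.End.mul_apply]
    exact (ih fun n hn => h n (hn.trans k.lt_succ_self)).compProd (fun _ => measureReal_nonneg)
      (fun _ => measureReal_nonneg) (h k k.lt_succ_self)

end AdaptiveComposition

/-! ### The region of the composed mixture -/

/-- The positively homogeneous functions. -/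
def homogeneous : Submodule ℝ (ℝ × ℝ → ℝ) where
  carrier := {h | ∀ w : ℝ, 0 ≤ w → ∀ x, h (w • x) = w * h x}
  add_mem' hf hg w hw x := by simp only [Pi.add_apply, hf w hw, hg w hw, mul_add]
  zero_mem' w hw x := by simp
  smul_mem' c f hf w hw x := by simp only [Pi.smul_apply, hf w hw, smul_eq_mul, mul_left_comm]

lemma hinge_mem_homogeneous : hinge ∈ homogeneous := fun _ hw x => hinge_smul hw x

lemma scale_mem_homogeneous (a b : ℝ) {h : ℝ × ℝ → ℝ} (hh : h ∈ homogeneous) :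
    scale a b h ∈ homogeneous := fun w hw x => by
  rw [scale_apply, scale_apply, ← hh w hw]
  simp [mul_assoc]

/-- This turns a visible random choice of component into a linear combination of operators.
Homogeneity is essential: it is not an identity of operators. -/
lemma scale_mul_left {w : ℝ} (hw : 0 ≤ w) (a b : ℝ) {h : ℝ × ℝ → ℝ} (hh : h ∈ homogeneous) :
    scale (w * a) (w * b) h = w • scale a b h := by
  ext x
  rw [Pi.smul_apply, scale_apply, scale_apply, smul_eq_mul, ← hh w hw]
  simp [mul_left_comm]

/-- The operator of one `ε`-randomized response. -/
noncomputable def rrOp (ε : ℝ) : Module.End ℝ (ℝ × ℝ → ℝ) :=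
  observe (randomizedResponse ε false) (randomizedResponse ε true)

/-- The operator of a revealed hypothesis. -/
def revealOp : Module.End ℝ (ℝ × ℝ → ℝ) := scale 0 1 + scale 1 0

/-- The operator of the mixture of two randomized responses. -/
noncomputable def mixOp (ε₁ ε₂ α : ℝ) : Module.End ℝ (ℝ × ℝ → ℝ) :=
  (1 - α) • rrOp ε₁ + α • rrOp ε₂

lemma rrOp_mem_homogeneous (ε : ℝ) {h : ℝ × ℝ → ℝ} (hh : h ∈ homogeneous) :
    rrOp ε h ∈ homogeneous := by
  rw [rrOp, observe_randomizedResponse]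
  exact add_mem (scale_mem_homogeneous _ _ hh) (scale_mem_homogeneous _ _ hh)

lemma mixOp_pow_mem_homogeneous (ε₁ ε₂ α : ℝ) (k : ℕ) {h : ℝ × ℝ → ℝ} (hh : h ∈ homogeneous) :
    (mixOp ε₁ ε₂ α ^ k) h ∈ homogeneous := by
  induction k with
  | zero => exact hh
  | succ k ih =>
    rw [pow_succ', Module.End.mul_apply]
    exact add_mem (Submodule.smul_mem _ _ (rrOp_mem_homogeneous _ ih))
      (Submodule.smul_mem _ _ (rrOp_mem_homogeneous _ ih))

lemma revealOp_hinge_apply (s t : ℝ) : revealOp hinge (s, t) = max 0 (-t) + max 0 s := by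
  simp [revealOp, hinge]

/-- Once the hypothesis is known a further response adds nothing: the profile splits into a function
of `s` and one of `t`, and each only sees a total mass of 1. -/
lemma rrOp_revealOp_hinge (ε : ℝ) : rrOp ε (revealOp hinge) = revealOp hinge := by
  ext ⟨s, t⟩
  have h0 : (0 : ℝ) ≤ 1 / (Real.exp ε + 1) := by positivity
  have h1 : (0 : ℝ) ≤ Real.exp ε / (Real.exp ε + 1) := by positivity
  have h2 : 1 / (Real.exp ε + 1) + Real.exp ε / (Real.exp ε + 1) = 1 := by field_simp; ring
  rw [rrOp, observe_randomizedResponse]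
  simp only [LinearMap.add_apply, Pi.add_apply, scale_apply, revealOp_hinge_apply]
  generalize 1 / (Real.exp ε + 1) = a at *
  generalize Real.exp ε / (Real.exp ε + 1) = b at *
  have e : ∀ u c : ℝ, 0 ≤ c → max 0 (u * c) = max 0 u * c := fun u c hc => by
    rw [max_mul_of_nonneg _ _ hc, zero_mul]
  rw [← neg_mul, ← neg_mul, e _ _ h0, e _ _ h1, e _ _ h0, e _ _ h1]
  linear_combination (max 0 (-t) + max 0 s) * h2

lemma revealOp_revealOp_hinge : revealOp (revealOp hinge) = revealOp hinge := by
  ext ⟨s, t⟩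
  simp [revealOp, hinge]

lemma commute_rrOp (ε ε' : ℝ) : Commute (rrOp ε) (rrOp ε') := commute_response _ _ _ _

lemma commute_revealOp_mixOp (ε₁ ε₂ α : ℝ) : Commute revealOp (mixOp ε₁ ε₂ α) := by
  have h : ∀ ε, Commute revealOp (rrOp ε) := fun ε => by
    rw [revealOp, rrOp, observe_randomizedResponse]
    exact .add_left (.add_right (commute_scale _ _ _ _) (commute_scale _ _ _ _))
      (.add_right (commute_scale _ _ _ _) (commute_scale _ _ _ _))
  exact .add_right ((h _).smul_right _) ((h _).smul_right _)

lemma mixOp_pow_revealOp_hinge (ε₁ ε₂ α : ℝ) (k : ℕ) :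
    (mixOp ε₁ ε₂ α ^ k) (revealOp hinge) = revealOp hinge := by
  induction k with
  | zero => rfl
  | succ k ih =>
    rw [pow_succ', Module.End.mul_apply, ih, mixOp, LinearMap.add_apply, LinearMap.smul_apply,
      LinearMap.smul_apply, rrOp_revealOp_hinge, rrOp_revealOp_hinge, ← add_smul,
      sub_add_cancel, one_smul]

section Mixture

variable {ε₁ ε₂ δ α : ℝ}

lemma observe_mixture_of_homogeneous (hδ : 0 ≤ δ) (hδ' : δ ≤ 1) (hα : 0 ≤ α) (hα' : α ≤ 1)
    {h : ℝ × ℝ → ℝ} (hh : h ∈ homogeneous) :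
    observe (mixture ε₁ ε₂ δ α false) (mixture ε₁ ε₂ δ α true) h =
      δ • revealOp h + (1 - δ) • mixOp ε₁ ε₂ α h := by
  have h1 : 0 ≤ (1 - δ) * (1 - α) := mul_nonneg (by linarith) (by linarith)
  have h2 : 0 ≤ (1 - δ) * α := mul_nonneg (by linarith) hα
  have e1 : scale 0 δ h = δ • scale 0 1 h := by rw [← scale_mul_left hδ 0 1 hh]; simp
  have e2 : scale δ 0 h = δ • scale 1 0 h := by rw [← scale_mul_left hδ 1 0 hh]; simp
  rw [observe_mixture hδ hδ' hα hα', mixOp, rrOp, rrOp, observe_randomizedResponse,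
    observe_randomizedResponse, revealOp]
  simp only [LinearMap.add_apply, LinearMap.smul_apply, scale_mul_left h1 _ _ hh,
    scale_mul_left h2 _ _ hh, e1, e2]
  module

/-- A revelation in any round absorbs all the others, so `mixOp` survives only when no round
reveals, which has probability `(1 - δ) ^ k`. -/
lemma observe_mixture_pow (hδ : 0 ≤ δ) (hδ' : δ ≤ 1) (hα : 0 ≤ α) (hα' : α ≤ 1) (k : ℕ) :
    (observe (mixture ε₁ ε₂ δ α false) (mixture ε₁ ε₂ δ α true) ^ k) hinge =
      (1 - (1 - δ) ^ k) • revealOp hinge + (1 - δ) ^ k • (mixOp ε₁ ε₂ α ^ k) hinge := by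
  induction k with
  | zero => simp
  | succ k ih =>
    have hr : revealOp hinge ∈ homogeneous :=
      add_mem (scale_mem_homogeneous _ _ hinge_mem_homogeneous)
        (scale_mem_homogeneous _ _ hinge_mem_homogeneous)
    have e1 : revealOp ((mixOp ε₁ ε₂ α ^ k) hinge) = revealOp hinge := by
      rw [← Module.End.mul_apply, ((commute_revealOp_mixOp ε₁ ε₂ α).pow_right k).eq,
        Module.End.mul_apply, mixOp_pow_revealOp_hinge]
    have e2 : mixOp ε₁ ε₂ α (revealOp hinge) = revealOp hinge := by
      simpa using mixOp_pow_revealOp_hinge ε₁ ε₂ α 1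
    rw [pow_succ', Module.End.mul_apply, ih, map_add, map_smul, map_smul,
      observe_mixture_of_homogeneous hδ hδ' hα hα' hr,
      observe_mixture_of_homogeneous hδ hδ' hα hα'
        (mixOp_pow_mem_homogeneous _ _ _ _ hinge_mem_homogeneous),
      revealOp_revealOp_hinge, e1, e2, ← Module.End.mul_apply, ← pow_succ']
    module

end Mixture

lemma observe_rr (ε₁ ε₂ : ℝ) (x y : ℕ) :
    observe
      ((kFold (randomizedResponse ε₁) x false).prod (kFold (randomizedResponse ε₂) y false))
      ((kFold (randomizedResponse ε₁) x true).prod (kFold (randomizedResponse ε₂) y true)) =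
    rrOp ε₁ ^ x * rrOp ε₂ ^ y := by
  rw [observe_prod, kFold, kFold, kFold, kFold, observe_pi, observe_pi, rrOp, rrOp]

lemma rrRegion_eq_supportRegion (ε₁ ε₂ : ℝ) (x y : ℕ) :
    rrRegion ε₁ ε₂ x y = supportRegion ((rrOp ε₁ ^ x * rrOp ε₂ ^ y) hinge) := by
  rw [rrRegion, privacyRegion_eq_supportRegion, observe_rr]

lemma isProfile_observe {Z : Type} [Fintype Z] [MeasurableSpace Z] [MeasurableSingletonClass Z]
    (P Q : Measure Z) [IsProbabilityMeasure P] [IsProbabilityMeasure Q] :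
    IsProfile (observe P Q hinge) :=
  ⟨Z, inferInstance, _, _, fun _ => measureReal_nonneg, fun _ => measureReal_nonneg,
    (sum_real_singleton P).trans (sum_real_singleton Q).symm, rfl⟩

lemma mixOp_pow_eq_sum (ε₁ ε₂ α : ℝ) (k : ℕ) :
    (mixOp ε₁ ε₂ α ^ k) hinge = ∑ j ∈ Finset.range (k + 1),
      ((k.choose j : ℝ) * (1 - α) ^ (k - j) * α ^ j) •
        (rrOp ε₁ ^ (k - j) * rrOp ε₂ ^ j) hinge := by
  have hc : Commute (α • rrOp ε₂) ((1 - α) • rrOp ε₁) :=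
    ((commute_rrOp ε₂ ε₁).smul_left _).smul_right _
  -- The summands are swapped so that the exponent `j` falls on the `ε₂`-response.
  rw [mixOp, add_comm, hc.add_pow, LinearMap.sum_apply]
  refine Finset.sum_congr rfl fun j _ => ?_
  rw [smul_pow, smul_pow, smul_mul_smul_comm, ((commute_rrOp ε₂ ε₁).pow_pow _ _).eq,
    ← nsmul_eq_mul', ← Nat.cast_smul_eq_nsmul ℝ, smul_smul, LinearMap.smul_apply]
  congr 1
  ring

lemma binomialRegion_eq_supportRegion (ε₁ ε₂ : ℝ) {α : ℝ} (hα : 0 ≤ α) (hα' : α ≤ 1) (k : ℕ) :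
    IsProfile ((mixOp ε₁ ε₂ α ^ k) hinge) ∧
      binomialRegion ε₁ ε₂ α k = supportRegion ((mixOp ε₁ ε₂ α ^ k) hinge) := by
  have := supportRegion_sum (Finset.range (k + 1))
    (w := fun j => (k.choose j : ℝ) * (1 - α) ^ (k - j) * α ^ j)
    (h := fun j => (rrOp ε₁ ^ (k - j) * rrOp ε₂ ^ j) hinge)
    (fun j _ => by have : 0 ≤ 1 - α := by linarith
                   positivity)
    (fun j _ => by rw [← observe_rr]; exact isProfile_observe _ _)
  rw [mixOp_pow_eq_sum, binomialRegion]
  refine ⟨this.1, ?_⟩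
  rw [this.2]
  exact Finset.sum_congr rfl fun j _ => by rw [rrRegion_eq_supportRegion]

lemma fullRegion_eq_supportRegion :
    IsProfile (revealOp hinge) ∧ fullRegion = supportRegion (revealOp hinge) := by
  constructor
  · refine ⟨Fin 2, inferInstance, ![1, 0], ![0, 1], ?_, ?_, by simp, by
      simp [response, revealOp]⟩ <;> intro z <;> fin_cases z <;> simp
  · ext β
    simp only [fullRegion, supportRegion, revealOp_hinge_apply, Set.mem_ofPred_eq]
    refine ⟨fun ⟨h1, h2, h3⟩ => ⟨h1, h2, by simpa using h3, fun s t hs ht => ?_⟩,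
      fun ⟨h1, h2, h3, _⟩ => ⟨h1, h2, by simpa using h3⟩⟩
    have := mul_nonneg ht h1
    have := mul_nonneg hs h2
    have := le_max_left 0 (-t)
    have := le_max_right 0 s
    simp only [neg_zero, max_self, max_eq_right zero_le_one, zero_add, mul_one]
    linarith

lemma composedRegion_eq_supportRegion (ε₁ ε₂ : ℝ) {δ α : ℝ} (hδ : 0 ≤ δ) (hδ' : δ ≤ 1)
    (hα : 0 ≤ α) (hα' : α ≤ 1) (k : ℕ) :
    composedRegion ε₁ ε₂ δ α k = supportRegion
      ((observe (mixture ε₁ ε₂ δ α false) (mixture ε₁ ε₂ δ α true) ^ k) hinge) := by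
  obtain ⟨p1, e1⟩ := fullRegion_eq_supportRegion
  obtain ⟨p2, e2⟩ := binomialRegion_eq_supportRegion ε₁ ε₂ hα hα' k
  have h0 : 0 ≤ (1 - δ) ^ k := pow_nonneg (by linarith) k
  have h1 : 0 ≤ 1 - (1 - δ) ^ k := sub_nonneg.2 (pow_le_one₀ (by linarith) (by linarith))
  obtain ⟨q1, f1⟩ := p1.supportRegion_smul h1
  obtain ⟨q2, f2⟩ := p2.supportRegion_smul h0
  rw [observe_mixture_pow hδ hδ' hα hα', (q1.supportRegion_add q2).2, f1, f2, ← e1, ← e2,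
    composedRegion]

/-! ### Slopes and offsets of the regions of randomized responses -/

/-- The binomial theorem for the two commuting outputs of each response; `i` and `j` count the
outputs of mass `exp ε / (exp ε + 1)` under `H₀`. -/
lemma rrOp_mul_hinge_apply (ε₁ ε₂ : ℝ) (x y : ℕ) (s t : ℝ) :
    (rrOp ε₁ ^ x * rrOp ε₂ ^ y) hinge (s, t) =
      (1 / (Real.exp ε₁ + 1)) ^ x * (1 / (Real.exp ε₂ + 1)) ^ y *
        ∑ j ∈ Finset.range (y + 1), ∑ i ∈ Finset.range (x + 1),
          (x.choose i : ℝ) * (y.choose j : ℝ) *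
            max 0 (s * Real.exp (((x : ℝ) - i) * ε₁ + ((y : ℝ) - j) * ε₂) -
              t * Real.exp (i * ε₁ + j * ε₂)) := by
  have hpow : ∀ (ε : ℝ) (n : ℕ), rrOp ε ^ n = ∑ i ∈ Finset.range (n + 1), (n.choose i : ℝ) •
      scale ((1 / (Real.exp ε + 1)) ^ n * Real.exp (((n : ℝ) - i) * ε))
        ((1 / (Real.exp ε + 1)) ^ n * Real.exp (i * ε)) := fun ε n => by
    rw [rrOp, observe_randomizedResponse, (commute_scale _ _ _ _).add_pow]
    refine Finset.sum_congr rfl fun i hi => ?_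
    have hi' : i ≤ n := Nat.lt_succ_iff.1 (Finset.mem_range.1 hi)
    rw [scale_pow, scale_pow, scale_mul_scale, ← nsmul_eq_mul', ← Nat.cast_smul_eq_nsmul ℝ,
      ← Nat.cast_sub hi', Real.exp_nat_mul, Real.exp_nat_mul]
    have e : (1 / (Real.exp ε + 1)) ^ n =
        (1 / (Real.exp ε + 1)) ^ i * (1 / (Real.exp ε + 1)) ^ (n - i) := by
      rw [← pow_add, Nat.add_sub_cancel' hi']
    congr 2
    · rw [e, div_pow (Real.exp ε), one_div_pow, one_div_pow]; ring
    · rw [e, div_pow (Real.exp ε), one_div_pow, one_div_pow]; ring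
  rw [hpow, hpow, Finset.sum_mul_sum, Finset.sum_comm, Finset.mul_sum, LinearMap.sum_apply,
    Finset.sum_apply]
  refine Finset.sum_congr rfl fun j _ => ?_
  rw [Finset.mul_sum, LinearMap.sum_apply, Finset.sum_apply]
  refine Finset.sum_congr rfl fun i _ => ?_
  have hN : 0 ≤ (1 / (Real.exp ε₁ + 1)) ^ x * (1 / (Real.exp ε₂ + 1)) ^ y := by positivity
  rw [smul_mul_smul_comm, scale_mul_scale, LinearMap.smul_apply, Pi.smul_apply, scale_apply,
    smul_eq_mul, hinge, Real.exp_add, Real.exp_add,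
    mul_left_comm ((1 / (Real.exp ε₁ + 1)) ^ x * (1 / (Real.exp ε₂ + 1)) ^ y), mul_max_of_nonneg _ _ hN, mul_zero]
  congr 2
  ring

/-- Exchanging the hypotheses exchanges the two outputs of each response. With `observe_hinge_neg`
this links the two inequalities of `dpRegion`. -/
lemma rrOp_pow_symm (ε₁ ε₂ : ℝ) (x y : ℕ) (s t : ℝ) :
    (rrOp ε₁ ^ x * rrOp ε₂ ^ y) hinge (-t, -s) = (rrOp ε₁ ^ x * rrOp ε₂ ^ y) hinge (s, t) := by
  have key : ∀ (ε : ℝ) (n : ℕ) (h : ℝ × ℝ → ℝ), (∀ s t, h (-t, -s) = h (s, t)) →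
      ∀ s t, (rrOp ε ^ n) h (-t, -s) = (rrOp ε ^ n) h (s, t) := fun ε n h hh => by
    induction n with
    | zero => exact hh
    | succ n ih =>
      intro s t
      rw [pow_succ', Module.End.mul_apply]
      generalize (rrOp ε ^ n) h = g at *
      rw [rrOp, observe_randomizedResponse]
      simp only [LinearMap.add_apply, Pi.add_apply, scale_apply, neg_mul, ih]
      exact add_comm _ _
  rw [Module.End.mul_apply]
  refine key _ _ _ (key _ _ _ fun s t => ?_) s t
  simp [hinge, add_comm, sub_eq_add_neg]

lemma observe_hinge_neg {Z : Type*} [Fintype Z] [MeasurableSpace Z] [MeasurableSingletonClass Z]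
    (P Q : Measure Z) [IsProbabilityMeasure P] [IsProbabilityMeasure Q] (s t : ℝ) :
    observe P Q hinge (s, t) = observe P Q hinge (-s, -t) + s - t := by
  have e : ∀ z, max 0 (s * Q.real {z} - t * P.real {z}) =
      max 0 (-s * Q.real {z} - -t * P.real {z}) + (s * Q.real {z} - t * P.real {z}) := fun z => by
    rcases le_total 0 (s * Q.real {z} - t * P.real {z}) with h | h
    · rw [max_eq_right h, max_eq_left (by linarith)]; ring
    · rw [max_eq_left h, max_eq_right (by linarith)]; ring
  rw [observe, response_hinge_apply, response_hinge_apply, Finset.sum_congr rfl fun z _ => e z,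
    Finset.sum_add_distrib, Finset.sum_sub_distrib, ← Finset.mul_sum, ← Finset.mul_sum,
    sum_real_singleton, sum_real_singleton]
  ring

/-- A piecewise linear function with nonnegative values at its breakpoints and nonnegative slope at
infinity is nonnegative. -/
lemma nonneg_of_nonneg_breakpoints {ι : Type*} (J : Finset ι) (B : Finset ℝ) (h0 : 0 ∈ B)
    (c d : ℝ) (w g : ι → ℝ) (hg : ∀ z ∈ J, g z ∈ B) (hd : 0 ≤ d)
    (h : ∀ b ∈ B, 0 ≤ c + d * b + ∑ z ∈ J, w z * max 0 (g z - b)) {l : ℝ} (hl : 0 ≤ l) :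
    0 ≤ c + d * l + ∑ z ∈ J, w z * max 0 (g z - l) := by
  classical
  have hne : (B.filter (· ≤ l)).Nonempty := ⟨0, Finset.mem_filter.2 ⟨h0, hl⟩⟩
  obtain ⟨b, hb, hmax⟩ := (B.filter (· ≤ l)).exists_max_image id hne
  rw [Finset.mem_filter] at hb
  have hmax' : ∀ r ∈ B, r ≤ l → r ≤ b := fun r h1 h2 => hmax r (Finset.mem_filter.2 ⟨h1, h2⟩)
  rcases (B.filter (l < ·)).eq_empty_or_nonempty with he | hne'
  · have hle : ∀ r ∈ B, r ≤ l := fun r hr => by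
      by_contra! hlt
      exact Finset.notMem_empty r (he ▸ Finset.mem_filter.2 ⟨hr, hlt⟩)
    have e : ∀ r, b ≤ r → ∑ z ∈ J, w z * max 0 (g z - r) = 0 := fun r hr =>
      Finset.sum_eq_zero fun z hz => by
        have := hmax' _ (hg z hz) (hle _ (hg z hz))
        rw [max_eq_left (by linarith), mul_zero]
    have := h b hb.1
    rw [e b le_rfl] at this
    rw [e l hb.2]
    nlinarith [hb.2]
  · obtain ⟨u, hu, hmin⟩ := (B.filter (l < ·)).exists_min_image id hne'
    rw [Finset.mem_filter] at hu
    have hbu : 0 < u - b := by linarith [hb.2, hu.2]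
    -- Between the neighbouring breakpoints `b ≤ l < u` the function is affine, so its value at `l`
    -- interpolates those at `b` and `u`.
    have e : (u - b) * (c + d * l + ∑ z ∈ J, w z * max 0 (g z - l)) =
        (u - l) * (c + d * b + ∑ z ∈ J, w z * max 0 (g z - b)) +
        (l - b) * (c + d * u + ∑ z ∈ J, w z * max 0 (g z - u)) := by
      have : (u - b) * ∑ z ∈ J, w z * max 0 (g z - l) =
          (u - l) * ∑ z ∈ J, w z * max 0 (g z - b) +
          (l - b) * ∑ z ∈ J, w z * max 0 (g z - u) := by
        rw [Finset.mul_sum, Finset.mul_sum, Finset.mul_sum, ← Finset.sum_add_distrib]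
        refine Finset.sum_congr rfl fun z hz => ?_
        rcases le_or_gt (g z) l with hz' | hz'
        · have := hmax' _ (hg z hz) hz'
          rw [max_eq_left (by linarith), max_eq_left (by linarith),
            max_eq_left (by linarith [hu.2])]
          ring
        · have : u ≤ g z := hmin _ (Finset.mem_filter.2 ⟨hg z hz, hz'⟩)
          rw [max_eq_right (by linarith), max_eq_right (by linarith),
            max_eq_right (by linarith)]
          ring
      linear_combination this
    refine nonneg_of_mul_nonneg_right ?_ hbu
    rw [e]
    exact add_nonneg (mul_nonneg (by linarith [hu.2]) (h b hb.1))
      (mul_nonneg (by linarith [hb.2]) (h u hu.1))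

lemma rrOp_pow_mul_mem_homogeneous (ε₁ ε₂ : ℝ) (x y : ℕ) :
    (rrOp ε₁ ^ x * rrOp ε₂ ^ y) hinge ∈ homogeneous := by
  have key : ∀ (ε : ℝ) (n : ℕ) (h : ℝ × ℝ → ℝ), h ∈ homogeneous → (rrOp ε ^ n) h ∈ homogeneous :=
    fun ε n h hh => by
      induction n with
      | zero => exact hh
      | succ n ih =>
        rw [pow_succ', Module.End.mul_apply]
        exact rrOp_mem_homogeneous _ ih
  exact key _ _ _ (key _ _ _ hinge_mem_homogeneous)

/-- Homogeneity normalises `s = 1`; then `l ↦ h (1, l)` is piecewise linear with breakpoints at the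
likelihood ratios `exp (rrEps ..)`. Ratios at least 1 use one inequality of `dpRegion`, the others
use the second one at the reciprocal ratio. -/
theorem rrRegion_eq_iInter (ε₁ ε₂ : ℝ) (hε₁ : 0 ≤ ε₁) (hε₂ : 0 ≤ ε₂) (x y : ℕ) :
    rrRegion ε₁ ε₂ x y = {β | ∀ a ≤ x, ∀ b ≤ y, 0 ≤ rrEps ε₁ ε₂ x y a b →
      β ∈ dpRegion (rrEps ε₁ ε₂ x y a b) (rrDelta ε₁ ε₂ x y a b)} := by
  classical
  rw [rrRegion_eq_supportRegion]
  set h : ℝ × ℝ → ℝ := (rrOp ε₁ ^ x * rrOp ε₂ ^ y) hinge with hh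
  have hhom : h ∈ homogeneous := rrOp_pow_mul_mem_homogeneous _ _ _ _
  have hone : h (1, 0) = 1 := by rw [hh, ← observe_rr, observe_hinge_one_zero]
  have hneg : ∀ s t, h (s, t) = h (-s, -t) + s - t := fun s t => by
    rw [hh, ← observe_rr, observe_hinge_neg]
  have hsymm : ∀ s t, h (-t, -s) = h (s, t) := rrOp_pow_symm _ _ _ _
  have hdelta : ∀ a b, rrDelta ε₁ ε₂ x y a b = h (1, Real.exp (rrEps ε₁ ε₂ x y a b)) :=
    fun a b => by
      rw [← hsymm, hh, rrOp_mul_hinge_apply, rrDelta]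
      congr 1
      refine Finset.sum_congr rfl fun j _ => Finset.sum_congr rfl fun i _ => ?_
      congr 2
      ring
  have hdelta' : ∀ a b, h (Real.exp (rrEps ε₁ ε₂ x y a b), 1) =
      rrDelta ε₁ ε₂ x y a b + Real.exp (rrEps ε₁ ε₂ x y a b) - 1 := fun a b => by
    rw [hneg, hsymm, hdelta]
  ext β
  simp only [supportRegion, dpRegion, Set.mem_ofPred_eq, hone, mul_one]
  constructor
  · rintro ⟨h1, h2, h3, h4⟩ a ha b hb -
    have k1 := h4 1 (Real.exp (rrEps ε₁ ε₂ x y a b)) zero_le_one (Real.exp_pos _).le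
    have k2 := h4 (Real.exp (rrEps ε₁ ε₂ x y a b)) 1 (Real.exp_pos _).le zero_le_one
    rw [← hdelta] at k1
    rw [hdelta'] at k2
    exact ⟨h1, h2, h3, by linarith, by linarith⟩
  · intro H
    obtain ⟨h1, h2, h3, -, -⟩ := H 0 x.zero_le 0 y.zero_le (by rw [rrEps]; simp; positivity)
    refine ⟨h1, h2, h3, fun s t hs ht => ?_⟩
    have hnn : ∀ s t, 0 ≤ h (s, t) := fun s t => by
      rw [hh, rrOp_mul_hinge_apply]
      exact mul_nonneg (by positivity) (Finset.sum_nonneg fun j _ => Finset.sum_nonneg fun i _ =>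
        mul_nonneg (by positivity) (le_max_left _ _))
    rcases hs.eq_or_lt with rfl | hs
    · have := mul_nonneg ht h1
      have := hnn 0 t
      linarith
    let J := Finset.range (y + 1) ×ˢ Finset.range (x + 1)
    let w : ℕ × ℕ → ℝ := fun z => (1 / (Real.exp ε₁ + 1)) ^ x * (1 / (Real.exp ε₂ + 1)) ^ y *
      ((x.choose z.2 : ℝ) * (y.choose z.1 : ℝ) * Real.exp (z.2 * ε₁ + z.1 * ε₂))
    let g : ℕ × ℕ → ℝ := fun z => Real.exp (rrEps ε₁ ε₂ x y z.2 z.1)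
    have hsum : ∀ l, h (1, l) = ∑ z ∈ J, w z * max 0 (g z - l) := fun l => by
      rw [hh, rrOp_mul_hinge_apply, ← Finset.sum_product', Finset.mul_sum]
      refine Finset.sum_congr rfl fun z _ => ?_
      have e : Real.exp (((x : ℝ) - z.2) * ε₁ + ((y : ℝ) - z.1) * ε₂) =
          Real.exp (z.2 * ε₁ + z.1 * ε₂) * g z := by
        simp only [g, ← Real.exp_add, rrEps]
        congr 1
        ring
      have e' : max 0 (1 * (Real.exp (z.2 * ε₁ + z.1 * ε₂) * g z) -
          l * Real.exp (z.2 * ε₁ + z.1 * ε₂)) =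
          Real.exp (z.2 * ε₁ + z.1 * ε₂) * max 0 (g z - l) := by
        rw [mul_max_of_nonneg _ _ (Real.exp_pos _).le, mul_zero]
        congr 1
        ring
      rw [e, e']
      simp only [w]
      ring
    -- The endpoint `0` joins the breakpoints because `l = t / s` ranges over the half-line; the
    -- slope at infinity is `β.1`.
    have key := nonneg_of_nonneg_breakpoints J (insert 0 (J.image g)) (Finset.mem_insert_self _ _)
      (β.2 - 1) β.1 w g (fun z hz => Finset.mem_insert_of_mem (Finset.mem_image_of_mem g hz)) h1
      (fun b hb => by
        rw [← hsum]
        rcases Finset.mem_insert.1 hb with rfl | hb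
        · rw [hone]; linarith
        obtain ⟨z, hz, rfl⟩ := Finset.mem_image.1 hb
        obtain ⟨hz1, hz2⟩ := Finset.mem_product.1 hz
        rw [Finset.mem_range, Nat.lt_succ_iff] at hz1 hz2
        rcases le_total 0 (rrEps ε₁ ε₂ x y z.2 z.1) with he | he
        · obtain ⟨-, -, -, -, k⟩ := H _ hz2 _ hz1 he
          rw [hdelta] at k
          simp only [g]
          linarith
        -- Reflecting both indices inverts the likelihood ratio; multiplying by `g z` then returns
        -- to the point `(1, g z)`.
        · have e : rrEps ε₁ ε₂ x y (x - z.2) (y - z.1) = -rrEps ε₁ ε₂ x y z.2 z.1 := by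
            rw [rrEps, rrEps, Nat.cast_sub hz2, Nat.cast_sub hz1]
            ring
          obtain ⟨-, -, -, k, -⟩ := H _ (x.sub_le z.2) _ (y.sub_le z.1) (by rw [e]; linarith)
          have k' := hdelta' (x - z.2) (y - z.1)
          rw [e] at k k'
          have hinv : g z * Real.exp (-rrEps ε₁ ε₂ x y z.2 z.1) = 1 := by
            rw [← Real.exp_add, add_neg_cancel, Real.exp_zero]
          have hg : 0 ≤ g z := (Real.exp_pos _).le
          have hm := hhom (g z) hg (Real.exp (-rrEps ε₁ ε₂ x y z.2 z.1), 1)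
          rw [Prod.smul_mk, smul_eq_mul, smul_eq_mul, hinv, mul_one] at hm
          rw [hm, k']
          have := mul_le_mul_of_nonneg_left k hg
          have : g z * (Real.exp (-rrEps ε₁ ε₂ x y z.2 z.1) * (β.2 - 1)) = β.2 - 1 := by
            rw [← mul_assoc, hinv, one_mul]
          linarith) (l := t / s) (div_nonneg ht hs.le)
    rw [← hsum] at key
    have hm := hhom s hs.le (1, t / s)
    rw [Prod.smul_mk, smul_eq_mul, smul_eq_mul, mul_one, mul_div_cancel₀ _ hs.ne'] at hm
    rw [hm]
    have k1 := mul_nonneg hs.le key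
    have k2 : s * (β.1 * (t / s)) = t * β.1 := by field_simp
    linarith

end DoubleDP

theorem mainTheorem1 (ε₁ δ₁ ε₂ δ₂ : ℝ) (hε₂ : 0 ≤ ε₂) (hε : ε₂ ≤ ε₁)
    (hδ₁ : δ₁ ∈ Set.Icc (0 : ℝ) 1) (hδ₂ : δ₂ ∈ Set.Icc (0 : ℝ) 1) (δ α : ℝ)
    (hδ : δ = DoubleDP.revealProb δ₁ δ₂) (hα : α = DoubleDP.mixWeight ε₁ δ₁ ε₂ δ₂) (k : ℕ) :
    -- the parameters are probabilities
    (0 ≤ δ ∧ δ ≤ 1 ∧ 0 ≤ α ∧ α ≤ 1) ∧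
    -- the mixture is a mechanism that satisfies both constraints
    ((∀ b, IsProbabilityMeasure (DoubleDP.mixture ε₁ ε₂ δ α b)) ∧
      DoubleDP.IsDP (fun b b' : Bool => b ≠ b') (DoubleDP.mixture ε₁ ε₂ δ α) ε₁ δ₁ ∧
      DoubleDP.IsDP (fun b b' : Bool => b ≠ b') (DoubleDP.mixture ε₁ ε₂ δ α) ε₂ δ₂) ∧
    -- the privacy region of its `k`-fold composition
    DoubleDP.privacyRegion (DoubleDP.kFold (DoubleDP.mixture ε₁ ε₂ δ α) k false)
      (DoubleDP.kFold (DoubleDP.mixture ε₁ ε₂ δ α) k true) =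
        DoubleDP.composedRegion ε₁ ε₂ δ α k ∧
    -- the same for the mixture without the revealing component
    DoubleDP.privacyRegion (DoubleDP.kFold (DoubleDP.mixture ε₁ ε₂ 0 α) k false)
      (DoubleDP.kFold (DoubleDP.mixture ε₁ ε₂ 0 α) k true) =
        DoubleDP.binomialRegion ε₁ ε₂ α k ∧
    -- the regions that are mixed, in terms of slopes and offsets
    (∀ x y : ℕ, DoubleDP.rrRegion ε₁ ε₂ x y =
      {β | ∀ a ≤ x, ∀ b ≤ y, 0 ≤ DoubleDP.rrEps ε₁ ε₂ x y a b →
        β ∈ DoubleDP.dpRegion (DoubleDP.rrEps ε₁ ε₂ x y a b)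
          (DoubleDP.rrDelta ε₁ ε₂ x y a b)}) ∧
    -- no mechanism with both constraints has a larger region when composed with itself `k` times
    (∀ (𝒟 : Type v) (adj : 𝒟 → 𝒟 → Prop) (Y : Type u) [MeasurableSpace Y] (M : 𝒟 → Measure Y),
      (∀ d d', adj d d' → adj d' d) →
      (∀ d, IsProbabilityMeasure (M d)) →
      DoubleDP.IsDP adj M ε₁ δ₁ → DoubleDP.IsDP adj M ε₂ δ₂ →
      ∀ d₀ d₁, adj d₀ d₁ →
        DoubleDP.privacyRegion (DoubleDP.kFold M k d₀) (DoubleDP.kFold M k d₁) ⊆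
          DoubleDP.composedRegion ε₁ ε₂ δ α k) ∧
    -- nor has an adaptive composition of `k` such mechanisms
    (∀ (𝒟 : Type v) (adj : 𝒟 → 𝒟 → Prop) (R : Type u) (Y : ℕ → Type u) [MeasurableSpace R]
      [∀ n, MeasurableSpace (Y n)] (A : DoubleDP.AdaptiveComposition 𝒟 R Y),
      (∀ d d', adj d d' → adj d' d) →
      (∀ n < k, ∀ h, DoubleDP.IsDP adj (A.mech n h) ε₁ δ₁ ∧
        DoubleDP.IsDP adj (A.mech n h) ε₂ δ₂ ∧ adj (A.db false n h) (A.db true n h)) →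
      DoubleDP.privacyRegion (A.law false k) (A.law true k) ⊆
        DoubleDP.composedRegion ε₁ ε₂ δ α k) := by
  obtain ⟨d0, d1, a0, a1⟩ := DoubleDP.parameters_mem hε hδ₁ hδ₂ hδ hα
  have hp := DoubleDP.isProbabilityMeasure_mixture (ε₁ := ε₁) (ε₂ := ε₂) d0 d1 a0 a1
  have hp0 := DoubleDP.isProbabilityMeasure_mixture (ε₁ := ε₁) (ε₂ := ε₂) le_rfl zero_le_one a0 a1
  have hone : ((DoubleDP.observe (DoubleDP.mixture ε₁ ε₂ δ α false)
      (DoubleDP.mixture ε₁ ε₂ δ α true) ^ k) DoubleDP.hinge) (1, 0) = 1 := by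
    rw [← DoubleDP.observe_pi, DoubleDP.observe_hinge_one_zero]
  have hregion := DoubleDP.composedRegion_eq_supportRegion ε₁ ε₂ d0 d1 a0 a1 k
  refine ⟨⟨d0, d1, a0, a1⟩, ⟨hp, DoubleDP.isDP_mixture hε₂ hε hδ₁ hδ₂ hδ hα⟩, ?_, ?_,
    DoubleDP.rrRegion_eq_iInter ε₁ ε₂ (hε₂.trans hε) hε₂, ?_, ?_⟩
  · rw [DoubleDP.privacyRegion_eq_supportRegion, DoubleDP.kFold, DoubleDP.kFold,
      DoubleDP.observe_pi, hregion]
  · rw [DoubleDP.privacyRegion_eq_supportRegion, DoubleDP.kFold, DoubleDP.kFold,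
      DoubleDP.observe_pi, DoubleDP.observe_mixture_pow le_rfl zero_le_one a0 a1,
      (DoubleDP.binomialRegion_eq_supportRegion ε₁ ε₂ a0 a1 k).2]
    -- With `δ = 0` the revealing term has weight `1 - 1 ^ k = 0`.
    simp
  · intro 𝒟 adj Y _ M hsymm hM h1 h2 d₀ d₁ had
    rw [hregion]
    exact ((DoubleDP.dominatedBy_mixture hε₂ hε hδ₁ hδ₂ hδ hα hsymm h1 h2 had).kFold
      k).privacyRegion_subset hone
  · intro 𝒟 adj R Y _ _ A hsymm hA
    rw [hregion]
    refine (A.dominatedBy_law fun n hn h => ?_).privacyRegion_subset hone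
    obtain ⟨h1, h2, had⟩ := hA n hn h
    have := A.isProbabilityMeasure_mech n h
    exact DoubleDP.dominatedBy_mixture hε₂ hε hδ₁ hδ₂ hδ hα hsymm h1 h2 had
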